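/- **Setting.** Let $X$ be a measurable space, $H$ a class of functions $X\to\{0,1\}$ of VC-dimension $d<\infty$, $h^*\in H$ a measurable target, and $D_1,\dots,D_k$ ($k\ge 2$) probability distributions on $X$ (the players). An example drawn from player $i$ is a pair $(x,h^*(x))$ with $x\sim D_i$. Let $A$ be any (jointly measurable) rule that, given a labelled sample consistent with some member of $H$, returns a member of $H$ consistent with it. Let $0<\varepsilon,\delta<1$, $\delta'=\delta/(2\log_2 k)$. **Personalized Learning.** Put $N_1=\{1,\dots,k\}$. For $j=1,\dots,\lceil\log_2 k\rceil$, as long as $N_j\neq\emptyset$: (first step) draw $m'$ examples from the mixture $D_{N_j}=\frac1{|N_j|}\sum_{i\in N_j}D_i$ and let $h_j$ be the hypothesis selected by $A$ on them; (TEST) every player $i\in N_j$ draws $\lceil K\ln(|N_j|/(\varepsilon\delta'))/\varepsilon\rceil$ new examples, and $G_j$ is the set of those $i\in N_j$ for which $h_j$ has empirical error at most $3\varepsilon/4$ on them; set $f_i=h_j$ for $i\in G_j$ and $N_{j+1}=N_j\setminus G_j$. The output is $(f_1,\dots,f_k)$. **Personalized Learning using Boosting** is the same algorithm, except that the first step is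 Distributed Boosting: $m$ reservoir slots are distributed uniformly at random among the players in $N_j$, each player fills its slots with its own examples, and then $T$ rounds of AdaBoost are run on the union of the reservoirs, starting from equal weights. In each round, $n$ points are resampled with replacement (each time, a player is chosen with probability proportional to the total weight of its reservoir, and this player chooses one of its points with probability proportional to its weight), $A$ is run on these points and returns a weak hypothesis $h$ with weighted error $e$ on the reservoirs, the weights of the points that $h$ classifies correctly are multiplied by $\beta=e/(1-e)$, and $h$ gets $\ln(1/\beta)$ votes; if $e=0$, then $h$ is returned. After $T$ rounds the weighted majority vote is returned. The sample cost of a run is the total number of examples drawn from the players in all steps (resampling is free). **Theorem.** The sample complexity of Personalized Learning using Boosting is $\tilde O\left(\log(k)\frac d\varepsilon\right)$ when $k\ln k=O(d)$, the same bound as for Personalized Learning. Precisely: there are absolute constants $p\in\mathbb N$ and $K>0$, and for every $c$ a constant $C>0$, such that for all $k\ge2$, $d$, $0<\varepsilon,\delta<1$ with $k\ln k\le c\,d$ there are $m,n,T,m'\in\mathbb N$, with $n\le K d$ and $T\le C\ln\left(2+\frac{d}{\varepsilon\delta}\right)$, such that for all $X$, $H$ of VC-dimension $d$ and $A$ as above,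 both Personalized Learning using Boosting (with parameters $m,n,T$) and Personalized Learning (with parameter $m'$) 1. satisfy the personalized collaborative PAC criterion: for all measurable $h^*\in H$ and all $D_1,\dots,D_k$, with probability at least $1-\delta$ every player $i$ has been assigned a classifier $f_i$ with $\Pr_{x\sim D_i}[f_i(x)\ne h^*(x)]<\varepsilon$; and 2. always draw at most $$C\,\log(k)\,\frac d\varepsilon\,\left(\ln\left(2+\frac d{\varepsilon\delta}\right)\right)^{p}$$ examples in total. -/

import Mathlib

open MeasureTheory
open scoped ENNReal NNReal

universe u v v'

/-- A hypothesis class `H` of binary classifiers shatters the finite set `s` if every labelling of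
`s` is realized by a member of `H`. -/
def ShattersSet {X : Type u} (H : Set (X → Bool)) (s : Finset X) : Prop :=
  ∀ y : X → Bool, ∃ h ∈ H, ∀ x ∈ s, h x = y x

/-- The VC dimension of a hypothesis class. -/
noncomputable def vcDim {X : Type u} (H : Set (X → Bool)) : ℕ∞ :=
  ⨆ s : {s : Finset X // ShattersSet H s}, (s.1.card : ℕ∞)

/-- Randomized algorithms that interact with `k` players holding unknown distributions on `X`.
* `ret a` stops with output `a`;
* `sample i c` obtains one fresh labelled example `z` from player `i` and continues with `c z`;
* `choose n w c` tosses internal coins: it picks `l : Fin n` with probability `w l / ∑ w` and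
  continues with `c l` (no fresh example is consumed). -/
inductive Prog (k : ℕ) (X : Type u) (α : Type v) : Type (max u v)
  | ret (a : α) : Prog k X α
  | sample (i : Fin k) (c : X × Bool → Prog k X α) : Prog k X α
  | choose (n : ℕ) (w : Fin n → ℝ≥0) (c : Fin n → Prog k X α) : Prog k X α

namespace Prog

variable {k : ℕ} {X : Type u} {α : Type v} {β : Type v'}

/-- Run `p`, then run `q` on its output. -/
def bind : Prog k X α → (α → Prog k X β) → Prog k X β
  | ret a, q => q a
  | sample i c, q => sample i fun z => bind (c z) q
  | choose n w c, q => choose n w fun l => bind (c l) q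

/-- Run finitely many programs one after the other and collect their outputs. -/
def each : (n : ℕ) → (Fin n → Prog k X α) → Prog k X (Fin n → α)
  | 0, _ => ret Fin.elim0
  | n + 1, p => bind (p 0) fun a => bind (each n fun q => p q.succ) fun v => ret (Fin.cons a v)

/-- One labelled example from player `i`. -/
def draw (i : Fin k) : Prog k X (X × Bool) := sample i ret

/-- The sample cost: the number of examples drawn from the players, in the worst case over the
examples received and the internal coins. -/
noncomputable def samples : Prog k X α → ℕ∞
  | ret _ => 0
  | sample _ c => 1 + ⨆ z, samples (c z)
  | choose _ _ c => ⨆ l, samples (c l)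

open Classical in
/-- The probability that the output satisfies `P`, when player `i` generates examples
`(x, hstar x)` with `x` distributed according to `D i`, all draws being independent. If a `choose`
instruction has total weight zero then it cannot be executed and the run counts as a failure
(in that case the summands below are zero). -/
noncomputable def prob [MeasurableSpace X] (D : Fin k → Measure X) (hstar : X → Bool)
    (P : α → Prop) : Prog k X α → ℝ≥0∞
  | ret a => if P a then 1 else 0
  | sample i c => ∫⁻ x, prob D hstar P (c (x, hstar x)) ∂(D i)
  | choose _ w c => ∑ l, ((w l : ℝ≥0∞) / ∑ l', (w l' : ℝ≥0∞)) * prob D hstar P (c l)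

end Prog

/-- A learning rule maps a labelled sample of any size to a classifier. -/
abbrev Learner (X : Type u) : Type u := (n : ℕ) → (Fin n → X × Bool) → X → Bool

/-- `A` selects a consistent hypothesis of `H` whenever there is one. -/
def Learner.IsConsistent {X : Type u} (A : Learner X) (H : Set (X → Bool)) : Prop :=
  ∀ (n : ℕ) (s : Fin n → X × Bool), (∃ h ∈ H, ∀ q, h (s q).1 = (s q).2) →
    A n s ∈ H ∧ ∀ q, A n s (s q).1 = (s q).2

/-- The prediction of the learned classifier is jointly measurable in the sample and the point. -/
def Learner.IsMeasurable {X : Type u} [MeasurableSpace X] (A : Learner X) : Prop :=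
  ∀ n : ℕ, Measurable fun p : (Fin n → X × Bool) × X => A n p.1 p.2

section Algorithms

variable {k : ℕ} {X : Type u}

/-- One example from the uniform mixture of the players in `N`, tagged with the player that
provides it. -/
noncomputable def drawMixture (N : Finset (Fin k)) : Prog k X (Fin k × (X × Bool)) :=
  Prog.choose k (fun i => if i ∈ N then 1 else 0) fun i =>
    Prog.bind (Prog.draw i) fun z => Prog.ret (i, z)

/-- First step of Personalized Learning: draw `m` examples from the uniform mixture of the players
in `N` and select a consistent hypothesis. -/
noncomputable def consistentStep (A : Learner X) (m : ℕ) (N : Finset (Fin k)) :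
    Prog k X (X → Bool) :=
  Prog.bind (Prog.each m fun _ => drawMixture N) fun S => Prog.ret (A m fun l => (S l).2)

/-- One resampled point of the reservoirs. The point `S l` belongs to the reservoir of the player
`(S l).1` and has weight `w l`. The center chooses a player with probability proportional to the
total weight of its reservoir; that player then chooses a point of its reservoir with
probability proportional to its weight. The output is the index of the chosen point. -/
noncomputable def resample {m : ℕ} (S : Fin m → Fin k × (X × Bool)) (w : Fin m → ℝ≥0) :
    Prog k X (Fin m) :=
  Prog.choose k (fun i => ∑ l, if (S l).1 = i then w l else 0) fun i =>
    Prog.choose m (fun l => if (S l).1 = i then w l else 0) Prog.ret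

/-- The weighted fraction of the reservoir points that `h` misclassifies. -/
noncomputable def weightedError {m : ℕ} (S : Fin m → Fin k × (X × Bool)) (w : Fin m → ℝ≥0)
    (h : X → Bool) : ℝ≥0 :=
  (∑ l, if h (S l).2.1 = (S l).2.2 then 0 else w l) / ∑ l, w l

open Classical in
/-- The boosting rounds of Distributed Boosting (AdaBoost on the union of the reservoirs). In each
round `n` points are resampled, the weak learner `A` is run on them, and, with `e` the weighted
error of its output and `b = e / (1 - e)`, the weights of the correctly classified points are
multiplied by `b` and the weak hypothesis receives `log (1 / b)` votes. `F` is the number of votes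
for the label `1` minus half of all votes so far. If `e = 0` the weak hypothesis would receive
infinitely many votes and is returned. -/
noncomputable def boostRounds (A : Learner X) (n : ℕ) {m : ℕ} (S : Fin m → Fin k × (X × Bool)) :
    ℕ → (Fin m → ℝ≥0) → (X → ℝ) → Prog k X (X → Bool)
  | 0, _, F => Prog.ret fun x => decide (0 ≤ F x)
  | T + 1, w, F =>
    Prog.bind (Prog.each n fun _ => resample S w) fun idx =>
      let h : X → Bool := A n fun q => (S (idx q)).2
      let e : ℝ≥0 := weightedError S w h
      let b : ℝ≥0 := e / (1 - e)
      if e = 0 then Prog.ret h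
      else boostRounds A n S T
        (fun l => if h (S l).2.1 = (S l).2.2 then w l * b else w l)
        (fun x => F x + Real.log (1 / (b : ℝ)) * ((if h x = true then 1 else 0) - 1 / 2))

/-- Distributed Boosting for the players in `N`: the center distributes `m` reservoir slots
uniformly at random among the players (so the reservoir sizes are uniform multinomial), every
player fills its slots with examples of its own, and `T` boosting rounds with `n` resampled points
each are run on these reservoirs, starting from equal weights. -/
noncomputable def distributedBoosting (A : Learner X) (m n T : ℕ) (N : Finset (Fin k)) :
    Prog k X (X → Bool) :=
  Prog.bind (Prog.each m fun _ => drawMixture N) fun S =>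
    boostRounds A n S T (fun _ => 1) (fun _ => 0)

/-- The empirical error of `h` on a labelled sample. -/
noncomputable def empiricalError {t : ℕ} (h : X → Bool) (z : Fin t → X × Bool) : ℝ :=
  (∑ q, if h (z q).1 = (z q).2 then (0 : ℝ) else 1) / (t : ℝ)

/-- Number of examples that every player of `N` draws in the `TEST` procedure. -/
noncomputable def testSize (K ε δ' : ℝ) (N : Finset (Fin k)) : ℕ :=
  ⌈K * (Real.log (N.card / (ε * δ')) / ε)⌉₊

open Classical in
/-- The `TEST` procedure: the players of `N` on whose fresh samples `h` has empirical error at most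
`3 ε / 4`. -/
noncomputable def testStep (K ε δ' : ℝ) (N : Finset (Fin k)) (h : X → Bool) :
    Prog k X (Finset (Fin k)) :=
  Prog.bind (Prog.each k fun i =>
      if i ∈ N then
        Prog.bind (Prog.each (testSize K ε δ' N) fun _ => Prog.draw i) fun z =>
          Prog.ret (decide (empiricalError h z ≤ 3 * ε / 4))
      else Prog.ret false) fun pass =>
    Prog.ret (N.filter fun i => pass i = true)

/-- The main loop, for a given first step `learn`: learn a classifier for the active players `N`,
test it, assign it to the players that pass, and go on with the other ones. -/
noncomputable def personalizedLoop (learn : Finset (Fin k) → Prog k X (X → Bool)) (K ε δ' : ℝ) :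
    ℕ → Finset (Fin k) → (Fin k → Option (X → Bool)) → Prog k X (Fin k → Option (X → Bool))
  | 0, _, f => Prog.ret f
  | r + 1, N, f =>
    if N = ∅ then Prog.ret f
    else Prog.bind (learn N) fun h => Prog.bind (testStep K ε δ' N h) fun G =>
      personalizedLoop learn K ε δ' r (N \ G) fun i => if i ∈ G then some h else f i

/-- `⌈log₂ k⌉` rounds of the main loop with confidence parameter `δ / (2 log₂ k)`, starting with
all players active and no classifier assigned. -/
noncomputable def personalizedWith (learn : Finset (Fin k) → Prog k X (X → Bool)) (K ε δ : ℝ) :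
    Prog k X (Fin k → Option (X → Bool)) :=
  personalizedLoop learn K ε (δ / (2 * Real.logb 2 k)) (Nat.clog 2 k) Finset.univ fun _ => none

/-- Personalized Learning, with `m` examples from the mixture in every round. -/
noncomputable def personalizedLearning (A : Learner X) (m : ℕ) (K ε δ : ℝ) :
    Prog k X (Fin k → Option (X → Bool)) :=
  personalizedWith (consistentStep A m) K ε δ

/-- Personalized Learning using Boosting: the first step is replaced by Distributed Boosting. -/
noncomputable def personalizedLearningBoosting (A : Learner X) (m n T : ℕ) (K ε δ : ℝ) :
    Prog k X (Fin k → Option (X → Bool)) :=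
  personalizedWith (distributedBoosting A m n T) K ε δ

/-- Every player has been assigned a classifier, and its error on the distribution of that player
is less than `ε`. -/
def AllAccurate [MeasurableSpace X] (D : Fin k → Measure X) (hstar : X → Bool) (ε : ℝ)
    (f : Fin k → Option (X → Bool)) : Prop :=
  ∀ i, ∃ g : X → Bool, f i = some g ∧ D i {x | g x ≠ hstar x} < ENNReal.ofReal ε

/-- The personalized collaborative PAC criterion in the realizable case: for every target in `H`
and all distributions of the players, with probability at least `1 - δ` every player ends up with
a classifier of error less than `ε`. -/
def IsPersonalizedPAC [MeasurableSpace X] (H : Set (X → Bool)) (ε δ : ℝ)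
    (p : Prog k X (Fin k → Option (X → Bool))) : Prop :=
  ∀ hstar ∈ H, Measurable hstar → ∀ D : Fin k → Measure X, (∀ i, IsProbabilityMeasure (D i)) →
    ENNReal.ofReal (1 - δ) ≤ p.prob D hstar (AllAccurate D hstar ε)

end Algorithms

/-! A round of the main loop succeeds if the learned classifier has error below ε/4 on the mixture
of the active players and all tests decide correctly. By Markov's inequality fewer than half of the
active players then have error above ε/2, so fewer than half stay active, and ⌈log₂ k⌉ successful
rounds serve everybody. Learning and testing may each fail with probability δ'/2 per round; since
⌈log₂ k⌉ ≤ 2 log₂ k, Bernoulli's inequality gives 1 - δ in total.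

For a consistent hypothesis, accuracy on the mixture is the double sampling bound of Vapnik and
Chervonenkis together with the Sauer–Shelah lemma. Boosting combines two facts. (i) A consistent
hypothesis on 512 d resampled points has weighted error below 1/4 except with probability 1/40
(`measure_weightedError_le`). The exponential loss therefore shrinks in expectation by the factor
7/8 + 1/40 = 9/10 per round, and after logarithmically many rounds the vote is likely to fit all
reservoir points (`le_expect_boostRounds`). (ii) For fixed resampled indices the vote is a
deterministic function of the reservoirs, with values in the weighted majorities of T members of H,
which have at most (2m+1)^(dT+T) traces on 2m points. The double sampling bound
`measure_exists_avoid_le` counts traces only, so it covers all choices of indices at once: with high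
probability every vote that fits the reservoirs is accurate, although the resampling depends on
them.

With L = log(2 + d/(εδ)), it is enough to take T of order L and m of order (d/ε) L². The assumption
k log k ≤ c d forces k = O(d), so the tests of a round cost no more than the learning, and there are
O(log k) rounds. -/

namespace Prog

/-! ### Expectations and laws of programs -/

variable {k : ℕ} {X : Type u} {α : Type v} {β : Type v'}

/-- The expectation of `f` at the output of a program; as for `Prog.prob`, runs that cannot be
continued count as zero. -/
noncomputable def expect [MeasurableSpace X] (D : Fin k → Measure X) (hstar : X → Bool) :
    Prog k X α → (α → ℝ≥0∞) → ℝ≥0∞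
  | ret a, f => f a
  | sample i c, f => ∫⁻ x, expect D hstar (c (x, hstar x)) f ∂(D i)
  | choose _ w c, f =>
    ∑ l, ((w l : ℝ≥0∞) / ∑ l', (w l' : ℝ≥0∞)) * expect D hstar (c l) f

section Expect

variable [MeasurableSpace X] {D : Fin k → Measure X} {hstar : X → Bool}

open Classical in
theorem prob_eq_expect (P : α → Prop) (p : Prog k X α) :
    p.prob D hstar P = p.expect D hstar fun a => if P a then 1 else 0 := by
  induction p with
  | ret a => rfl
  | sample i c ih => simp only [prob, expect, ih]
  | choose n w c ih => simp only [prob, expect, ih]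

theorem expect_bind (p : Prog k X α) (q : α → Prog k X β) (f : β → ℝ≥0∞) :
    (bind p q).expect D hstar f = p.expect D hstar fun a => (q a).expect D hstar f := by
  induction p with
  | ret a => rfl
  | sample i c ih => simp only [bind, expect, ih]
  | choose n w c ih => simp only [bind, expect, ih]

theorem expect_mono (p : Prog k X α) {f g : α → ℝ≥0∞} (h : ∀ a, f a ≤ g a) :
    p.expect D hstar f ≤ p.expect D hstar g := by
  induction p with
  | ret a => exact h a
  | sample i c ih => exact lintegral_mono fun x => ih _
  | choose n w c ih => exact Finset.sum_le_sum fun l _ => mul_le_mul_right (ih l) _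

/-- Equality may fail: the integrand need not be measurable, and `∫⁻` is then only a lower integral.
The direction proved is the one that lower bounds on success probabilities need, so programs can be
composed without any measurability of their continuations. -/
theorem mul_expect_le (p : Prog k X α) (r : ℝ≥0∞) (f : α → ℝ≥0∞) :
    r * p.expect D hstar f ≤ p.expect D hstar fun a => r * f a := by
  induction p with
  | ret a => exact le_rfl
  | sample i c ih => exact (lintegral_const_mul_le _ _).trans (lintegral_mono fun x => ih _)
  | choose n w c ih =>
    simp only [expect, Finset.mul_sum]
    refine Finset.sum_le_sum fun l _ => ?_
    rw [mul_left_comm]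
    exact mul_le_mul_right (ih l) _

/-- If `p` reaches the event `Q` with probability at least `r` and the continuation has expectation
at least `s` on `Q`, then the composition has expectation at least `r * s`. -/
theorem mul_le_expect_bind {p : Prog k X α} {q : α → Prog k X β} {f : β → ℝ≥0∞} {Q : Set α}
    {r s : ℝ≥0∞} (hp : r ≤ p.expect D hstar (Q.indicator 1))
    (hq : ∀ a ∈ Q, s ≤ (q a).expect D hstar f) :
    r * s ≤ (bind p q).expect D hstar f := by
  rw [expect_bind, mul_comm]
  refine (mul_le_mul_right hp s).trans ((mul_expect_le _ _ _).trans (expect_mono _ fun a => ?_))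
  by_cases ha : a ∈ Q
  · simpa [ha] using hq a ha
  · simp [ha]

theorem expect_each_succ (n : ℕ) (p : Fin (n + 1) → Prog k X α)
    (f : (Fin (n + 1) → α) → ℝ≥0∞) :
    (each (n + 1) p).expect D hstar f =
      (p 0).expect D hstar fun a =>
        (each n fun q => p q.succ).expect D hstar fun v => f (Fin.cons a v) := by
  simp only [each, expect_bind, expect]

/-- Independent runs reach a product event with at least the product of the probabilities. -/
theorem prod_le_expect_each (n : ℕ) (p : Fin n → Prog k X α) (Q : Fin n → Set α)
    (r : Fin n → ℝ≥0∞) (h : ∀ i, r i ≤ (p i).expect D hstar ((Q i).indicator 1)) :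
    ∏ i, r i ≤ (each n p).expect D hstar ({v | ∀ i, v i ∈ Q i}.indicator 1) := by
  induction n with
  | zero => simp [each, expect]
  | succ n ih =>
    rw [Fin.prod_univ_succ, each]
    refine mul_le_expect_bind (h 0) fun a ha => ?_
    have := ih (fun q => p q.succ) (fun q => Q q.succ) (fun q => r q.succ) fun q => h q.succ
    rw [expect_bind]
    refine this.trans (expect_mono _ fun v => ?_)
    simp only [expect]
    by_cases hv : ∀ q : Fin n, v q ∈ Q q.succ
    · have hc : ∀ q : Fin (n + 1), (Fin.cons a v : Fin (n + 1) → α) q ∈ Q q :=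
        fun q => Fin.cases (by simpa using ha) (fun q => by simpa using hv q) q
      simp [hv, hc]
    · simp [hv]

/-- The output of `p` has the law of `ψ z`, where `z` is distributed according to `μ`. -/
def HasLaw {Z : Type*} [MeasurableSpace Z] (D : Fin k → Measure X) (hstar : X → Bool)
    (p : Prog k X α) (μ : Measure Z) (ψ : Z → α) : Prop :=
  ∀ f : α → ℝ≥0∞, Measurable (fun z => f (ψ z)) → p.expect D hstar f = ∫⁻ z, f (ψ z) ∂μ

/-- Tonelli, one coordinate at a time. This is why `HasLaw` admits only test functions that are
measurable after composition with `ψ`. -/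
theorem HasLaw.each {Z : Type*} [MeasurableSpace Z] {μ : Measure Z} [SigmaFinite μ] {ψ : Z → α}
    {p : Prog k X α} (hp : HasLaw D hstar p μ ψ) (n : ℕ) :
    HasLaw D hstar (Prog.each n fun _ => p) (Measure.pi fun _ : Fin n => μ)
      (fun s q => ψ (s q)) := by
  induction n with
  | zero =>
    intro f hf
    rw [Measure.pi_of_empty, lintegral_dirac' _ hf]
    simp only [Prog.each, expect]
    congr 1
    exact Subsingleton.elim _ _
  | succ n ih =>
    intro f hf
    have e := (measurePreserving_piFinSuccAbove (fun _ : Fin (n + 1) => μ) 0).symm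
    have key : ∀ (z : Z) (s : Fin n → Z), (fun q => ψ ((Fin.cons z s : Fin (n + 1) → Z) q)) =
        (Fin.cons (ψ z) fun q => ψ (s q) : Fin (n + 1) → α) := by
      intro z s
      funext q
      refine Fin.cases ?_ (fun q => ?_) q <;> simp
    have hm : Measurable fun y : Z × (Fin n → Z) =>
        f (Fin.cons (ψ y.1) fun q => ψ (y.2 q)) := by
      have := hf.comp e.measurable
      simp only [← key]
      convert this using 2
      simp [MeasurableEquiv.piFinSuccAbove, Fin.insertNthEquiv]
    rw [expect_each_succ, ← e.lintegral_comp hf, lintegral_prod _ ?_]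
    · have h1 : ∀ z, (Prog.each n fun _ => p).expect D hstar
          (fun v => f (Fin.cons (ψ z) v)) =
            ∫⁻ s, f (Fin.cons (ψ z) fun q => ψ (s q)) ∂Measure.pi fun _ : Fin n => μ :=
        fun z => ih _ (hm.comp measurable_prodMk_left)
      rw [hp]
      · refine lintegral_congr fun z => ?_
        rw [h1]
        refine lintegral_congr fun s => ?_
        rw [← key]
        simp [MeasurableEquiv.piFinSuccAbove, Fin.insertNthEquiv]
      · simp only [h1]
        exact hm.lintegral_prod_right'
    · exact (hf.comp e.measurable).aemeasurable

theorem hasLaw_draw (i : Fin k) (D : Fin k → Measure X) (hstar : X → Bool) :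
    HasLaw D hstar (draw i) (D i) fun x => (x, hstar x) :=
  fun _ _ => rfl

end Expect

/-! ### Worst-case sample cost of composed programs -/

section Samples

theorem samples_bind_le {p : Prog k X α} {q : α → Prog k X β} {a b : ℕ∞}
    (hp : p.samples ≤ a) (hq : ∀ x, (q x).samples ≤ b) : (bind p q).samples ≤ a + b := by
  have : (bind p q).samples ≤ p.samples + b := by
    clear hp
    induction p with
    | ret x => simpa [bind, samples] using hq x
    | sample i c ih =>
      simp only [bind, samples, add_assoc]
      gcongr
      refine iSup_le fun z => (ih z).trans ?_
      gcongr
      exact le_iSup (fun z => (c z).samples) z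
    | choose n w c ih =>
      simp only [bind, samples]
      refine iSup_le fun z => (ih z).trans ?_
      gcongr
      exact le_iSup (fun z => (c z).samples) z
  exact this.trans (by gcongr)

theorem samples_each_le (n : ℕ) {p : Fin n → Prog k X α} {a : ℕ∞}
    (hp : ∀ i, (p i).samples ≤ a) : (each n p).samples ≤ n * a := by
  induction n with
  | zero => simp [each, samples]
  | succ n ih =>
    rw [each]
    refine (samples_bind_le (hp 0) (b := n * a + 0) fun x => samples_bind_le
      (ih fun i => hp i.succ) fun y => by simp [samples]).trans ?_
    rw [add_zero, Nat.cast_succ, add_mul, one_mul, add_comm]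

theorem samples_draw_le (i : Fin k) : (draw i : Prog k X (X × Bool)).samples ≤ 1 := by
  simp [draw, samples]

end Samples

end Prog

/-! ### Growth functions of H and of its weighted majorities -/

section Growth

open Classical in
/-- The labellings that the members of `H` induce on the points `u j`, as sets of indices. -/
noncomputable def traces {X ι : Type*} [Fintype ι] (H : Set (X → Bool)) (u : ι → X) :
    Finset (Finset ι) :=
  Finset.univ.filter fun P => ∃ h ∈ H, ∀ j, j ∈ P ↔ h (u j) = true

theorem mem_traces {X ι : Type*} [Fintype ι] {H : Set (X → Bool)} {u : ι → X} {P : Finset ι} :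
    P ∈ traces H u ↔ ∃ h ∈ H, ∀ j, j ∈ P ↔ h (u j) = true := by
  simp [traces]

theorem Finset.card_le_sum_choose_of_shatters {ι : Type*} [Fintype ι] [DecidableEq ι]
    (𝒜 : Finset (Finset ι)) (D : ℕ) (h : ∀ t, 𝒜.Shatters t → t.card ≤ D) :
    𝒜.card ≤ ∑ i ∈ Finset.Iic D, (Fintype.card ι).choose i := by
  refine (card_le_card_shatterer 𝒜).trans (card_shatterer_le_sum_vcDim.trans ?_)
  refine Finset.sum_le_sum_of_subset (Finset.Iic_subset_Iic.2 ?_)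
  exact Finset.sup_le fun t ht => h t (mem_shatterer.1 ht)

theorem sum_choose_le_pow (N D : ℕ) : ∑ i ∈ Finset.Iic D, N.choose i ≤ (N + 1) ^ D := by
  rw [add_pow, ← Nat.range_succ_eq_Iic]
  refine Finset.sum_le_sum fun i hi => ?_
  have hi' : i ≤ D := by simpa [Nat.lt_succ_iff] using hi
  calc N.choose i ≤ N ^ i * 1 := by simpa using Nat.choose_le_pow N i
    _ ≤ N ^ i * D.choose i := Nat.mul_le_mul_left _ (Nat.choose_pos hi')
    _ = _ := by simp

/-- Multiply each term by (N/D)^(D-i) ≥ 1 and extend the sum to the full binomial sum (1 + D/N)^N ≤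
e^D. The ratio N/D in place of N is what lets a number of resampled points linear in d suffice. -/
theorem sum_choose_le_exp {N D : ℕ} (hD : 0 < D) (hN : D ≤ N) :
    (∑ i ∈ Finset.Iic D, N.choose i : ℝ) ≤ (Real.exp 1 * (N / D)) ^ D := by
  have hD' : (0 : ℝ) < D := by exact_mod_cast hD
  have hN' : (D : ℝ) ≤ N := by exact_mod_cast hN
  have hN0 : (0 : ℝ) < N := hD'.trans_le hN'
  have h1 : (1 : ℝ) ≤ N / D := (one_le_div hD').2 hN'
  calc (∑ i ∈ Finset.Iic D, N.choose i : ℝ)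
      ≤ ∑ i ∈ Finset.Iic D, (N / D : ℝ) ^ D * ((D / N : ℝ) ^ i * N.choose i) := by
        refine Finset.sum_le_sum fun i hi => ?_
        have hi' : i ≤ D := by simpa using hi
        have : (1 : ℝ) ≤ (N / D : ℝ) ^ D * (D / N : ℝ) ^ i := by
          have e : (N / D : ℝ) ^ D * (D / N : ℝ) ^ i = (N / D : ℝ) ^ (D - i) := by
            have h2 : (N / D : ℝ) * (D / N) = 1 := by field_simp
            rw [show (N / D : ℝ) ^ D = (N / D : ℝ) ^ (D - i) * (N / D : ℝ) ^ i by
              rw [← pow_add, Nat.sub_add_cancel hi'], mul_assoc, ← mul_pow, h2, one_pow, mul_one]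
          rw [e]
          exact one_le_pow₀ h1
        rw [← mul_assoc]
        exact le_mul_of_one_le_left (by positivity) this
    _ ≤ ∑ i ∈ Finset.Iic N, (N / D : ℝ) ^ D * ((D / N : ℝ) ^ i * N.choose i) :=
        Finset.sum_le_sum_of_subset_of_nonneg (Finset.Iic_subset_Iic.2 hN)
          fun _ _ _ => by positivity
    _ = (N / D : ℝ) ^ D * (D / N + 1 : ℝ) ^ N := by
        rw [← Finset.mul_sum, add_pow, ← Nat.range_succ_eq_Iic]
        simp
    _ ≤ (N / D : ℝ) ^ D * Real.exp 1 ^ D := by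
        have : (D / N + 1 : ℝ) ^ N ≤ Real.exp (D / N) ^ N :=
          pow_le_pow_left₀ (by positivity) (Real.add_one_le_exp _) _
        rw [← Real.exp_nat_mul, mul_div_cancel₀ _ hN0.ne'] at this
        rw [← Real.exp_nat_mul, mul_one]
        gcongr
    _ = _ := by rw [mul_pow, mul_comm]

theorem card_traces_le {X ι : Type*} [Fintype ι] {H : Set (X → Bool)} {d : ℕ}
    (hH : vcDim H ≤ d) (u : ι → X) :
    (traces H u).card ≤ ∑ i ∈ Finset.Iic d, (Fintype.card ι).choose i := by
  classical
  refine Finset.card_le_sum_choose_of_shatters _ _ fun t ht => ?_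
  -- Indices that carry the same point always get the same label, so a shattered set of indices
  -- carries distinct points.
  have inj : Set.InjOn u t := by
    intro i hi j hj hij
    by_contra hne
    obtain ⟨P, hP, hPt⟩ := ht (Finset.singleton_subset_iff.2 hi)
    obtain ⟨h, -, hh⟩ := mem_traces.1 hP
    have h1 : i ∈ P := (Finset.mem_inter.1 (hPt ▸ Finset.mem_singleton_self i)).2
    have h2 : j ∈ P := (hh j).2 (hij ▸ (hh i).1 h1)
    have : j ∈ t ∩ P := Finset.mem_inter.2 ⟨hj, h2⟩
    rw [hPt] at this
    exact hne (Finset.mem_singleton.1 this).symm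
  have sh : ShattersSet H (t.image u) := by
    intro y
    obtain ⟨P, hP, hPt⟩ := ht (Finset.filter_subset (fun j => y (u j) = true) t)
    obtain ⟨h, hh, hhP⟩ := mem_traces.1 hP
    refine ⟨h, hh, fun x hx => ?_⟩
    obtain ⟨j, hj, rfl⟩ := Finset.mem_image.1 hx
    have h1 : j ∈ t ∩ P ↔ j ∈ t.filter fun j => y (u j) = true := by rw [hPt]
    simp only [Finset.mem_inter, Finset.mem_filter, hj, true_and] at h1
    exact Bool.eq_iff_iff.2 ((hhP j).symm.trans h1)
  have h2 : ((t.image u).card : ℕ∞) ≤ vcDim H :=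
    le_iSup (fun s : {s : Finset X // ShattersSet H s} => (s.1.card : ℕ∞)) ⟨_, sh⟩
  rw [Finset.card_image_of_injOn inj] at h2
  exact_mod_cast h2.trans hH

/-- Classes of sign patterns of a `T`-dimensional space of functions have VC dimension at
most `T`. -/
theorem card_le_of_shatters_nonneg {ι : Type*} [Fintype ι] [DecidableEq ι] {T : ℕ}
    (V : (Fin T → ℝ) →ₗ[ℝ] (ι → ℝ)) {𝒜 : Finset (Finset ι)}
    (h𝒜 : ∀ P ∈ 𝒜, ∃ a, ∀ j, j ∈ P ↔ 0 ≤ V a j) {t : Finset ι} (ht : 𝒜.Shatters t) :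
    t.card ≤ T := by
  by_contra! hlt
  let R : (Fin T → ℝ) →ₗ[ℝ] (t → ℝ) := (LinearMap.funLeft ℝ ℝ (Subtype.val : t → ι)).comp V
  -- With more than T indices, the restrictions to `t` form a proper subspace and are annihilated by
  -- a nonzero functional.
  have hR : LinearMap.range R < ⊤ := by
    refine lt_top_iff_ne_top.2 fun htop => ?_
    have h1 := LinearMap.finrank_range_le R
    rw [htop] at h1
    simp at h1
    omega
  obtain ⟨f, hf, hle⟩ := Submodule.exists_le_ker_of_lt_top _ hR
  have hsum : ∀ x : t → ℝ, f x = ∑ j, x j * f (fun i => if j = i then 1 else 0) := fun x => by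
    simpa using LinearMap.pi_apply_eq_sum_univ f x
  -- The sign of the annihilator is chosen so that it has a negative entry: on the pattern of its
  -- signs, V a is only known to be nonnegative where l ≥ 0 but is strictly negative where l < 0. A
  -- negative entry makes the sum strictly positive, although it vanishes.
  obtain ⟨l, hl, j₀, hj₀⟩ : ∃ l : t → ℝ, (∀ a, ∑ j : t, V a j * l j = 0) ∧ ∃ j₀, l j₀ < 0 := by
    have hz : ∀ a, ∑ j : t, V a j * f (fun i => if j = i then 1 else 0) = 0 := fun a =>
      (hsum (R a)).symm.trans (LinearMap.mem_ker.1 (hle (LinearMap.mem_range_self R a)))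
    have hne : ∃ j : t, f (fun i => if j = i then 1 else 0) ≠ 0 := by
      by_contra! hall
      exact hf (LinearMap.ext fun x => by rw [hsum]; simp [hall])
    obtain ⟨j, hj⟩ := hne
    rcases lt_or_gt_of_ne hj with h | h
    · exact ⟨_, hz, j, h⟩
    · refine ⟨fun j => -f (fun i => if j = i then 1 else 0), fun a => ?_, j, by linarith⟩
      simpa using hz a
  obtain ⟨P, hP, hPt⟩ := ht (Finset.filter_subset (fun j => ∃ h : j ∈ t, 0 ≤ l ⟨j, h⟩) t)
  obtain ⟨a, ha⟩ := h𝒜 P hP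
  have key : ∀ j : t, 0 ≤ V a j ↔ 0 ≤ l j := by
    intro j
    have h1 : (j : ι) ∈ t ∩ P ↔ (j : ι) ∈ t.filter fun j => ∃ h : j ∈ t, 0 ≤ l ⟨j, h⟩ := by
      rw [hPt]
    simp only [Finset.mem_inter, Finset.mem_filter, j.2, true_and, exists_true_left] at h1
    exact (ha j).symm.trans h1
  have hpos : 0 < ∑ j : t, V a j * l j := by
    refine Finset.sum_pos' (fun j _ => ?_) ⟨j₀, Finset.mem_univ _, ?_⟩
    · by_cases h : 0 ≤ l j
      · exact mul_nonneg ((key j).2 h) h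
      · exact mul_nonneg_of_nonpos_of_nonpos (not_le.1 fun h' => h ((key j).1 h')).le
          (not_le.1 h).le
    · exact mul_pos_of_neg_of_neg (not_le.1 fun h' => hj₀.not_ge ((key j₀).1 h')) hj₀
  exact hpos.ne' (hl a)

/-- Weighted majority votes of `T` members of `H`. -/
def majorityClass {X : Type*} (H : Set (X → Bool)) (T : ℕ) : Set (X → Bool) :=
  {g | ∃ (h : Fin T → X → Bool) (a : Fin T → ℝ), (∀ t, h t ∈ H) ∧
    ∀ x, g x = true ↔ 0 ≤ ∑ t, a t * ((if h t x = true then 1 else 0) - 1 / 2)}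

/-- Once the label patterns of the T voters are fixed, the majorities are sign patterns of a
T-dimensional space of functions on the indices. -/
theorem card_traces_majorityClass_le {X ι : Type*} [Fintype ι] (H : Set (X → Bool)) (T : ℕ)
    (u : ι → X) :
    (traces (majorityClass H T) u).card ≤
      (traces H u).card ^ T * ∑ i ∈ Finset.Iic T, (Fintype.card ι).choose i := by
  classical
  let S : (Fin T → Finset ι) → Finset (Finset ι) := fun p => Finset.univ.filter fun P =>
    ∃ a : Fin T → ℝ, ∀ j, j ∈ P ↔ 0 ≤ ∑ t, a t * ((if j ∈ p t then 1 else 0) - 1 / 2)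
  have hsub : traces (majorityClass H T) u ⊆
      (Fintype.piFinset fun _ : Fin T => traces H u).biUnion S := by
    intro P hP
    obtain ⟨g, ⟨h, a, hH, hg⟩, hgP⟩ := mem_traces.1 hP
    refine Finset.mem_biUnion.2 ⟨fun t => Finset.univ.filter fun j => h t (u j) = true, ?_, ?_⟩
    · exact Fintype.mem_piFinset.2 fun t => mem_traces.2 ⟨h t, hH t, by simp⟩
    · simp only [S, Finset.mem_filter, Finset.mem_univ, true_and]
      exact ⟨a, fun j => (hgP j).trans (hg _)⟩
  refine (Finset.card_le_card hsub).trans ?_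
  have hS : ∀ p, (S p).card ≤ ∑ i ∈ Finset.Iic T, (Fintype.card ι).choose i := by
    intro p
    let V : (Fin T → ℝ) →ₗ[ℝ] (ι → ℝ) :=
      LinearMap.pi fun j => ∑ t, ((if j ∈ p t then (1 : ℝ) else 0) - 1 / 2) • LinearMap.proj t
    refine Finset.card_le_sum_choose_of_shatters _ _ fun t ht =>
      card_le_of_shatters_nonneg V (fun P hP => ?_) ht
    obtain ⟨a, ha⟩ := (Finset.mem_filter.1 hP).2
    refine ⟨a, fun j => (ha j).trans ?_⟩
    simp [V, mul_comm]
  refine (Finset.card_biUnion_le_card_mul _ _ _ fun p _ => hS p).trans ?_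
  rw [Fintype.card_piFinset]
  simp

end Growth

/-! ### Chernoff bounds for the number of hits -/

section Concentration

open Classical in
/-- The number of coordinates of `s` that lie in `E`. -/
noncomputable def hits {Z : Type*} {n : ℕ} (E : Set Z) (s : Fin n → Z) : ℝ :=
  ∑ i, if s i ∈ E then 1 else 0

variable {Z : Type*} [MeasurableSpace Z]

theorem lintegral_pi_prod_eq_pow (μ : Measure Z) [IsProbabilityMeasure μ] (n : ℕ)
    {f : Z → ℝ≥0∞} (hf : Measurable f) :
    ∫⁻ s, ∏ i, f (s i) ∂(Measure.pi fun _ : Fin n => μ) = (∫⁻ z, f z ∂μ) ^ n := by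
  have h := ProbabilityTheory.iIndepFun_pi (μ := fun _ : Fin n => μ) (X := fun _ => f)
    fun _ => hf.aemeasurable
  rw [ProbabilityTheory.lintegral_prod_eq_prod_lintegral_of_indepFun Finset.univ _ h
    fun i => hf.comp (measurable_pi_apply i)]
  have : ∀ i : Fin n, ∫⁻ s : Fin n → Z, f (s i) ∂(Measure.pi fun _ : Fin n => μ) =
      ∫⁻ z, f z ∂μ := fun i =>
    (measurePreserving_eval (fun _ : Fin n => μ) i).lintegral_comp hf
  simp [this]

/-- Exponential Markov inequality for the number of hits. -/
theorem measure_hits_le (μ : Measure Z) [IsProbabilityMeasure μ] (n : ℕ) {E : Set Z}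
    (hE : MeasurableSet E) {a : ℝ} (ha : 0 < a) (θ : ℝ) :
    (Measure.pi fun _ : Fin n => μ) {s | θ * Real.log a ≤ hits E s * Real.log a} ≤
      ENNReal.ofReal (Real.exp (n * ((a - 1) * μ.real E) - θ * Real.log a)) := by
  classical
  have hf : Measurable fun z => if z ∈ E then ENNReal.ofReal a else 1 :=
    Measurable.ite hE measurable_const measurable_const
  have hprod : ∀ s : Fin n → Z, ∏ i, (if s i ∈ E then ENNReal.ofReal a else 1) =
      ENNReal.ofReal (Real.exp (hits E s * Real.log a)) := by
    intro s
    rw [hits, Finset.sum_mul, Real.exp_sum, ENNReal.ofReal_prod_of_nonneg fun _ _ => by positivity]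
    refine Finset.prod_congr rfl fun i _ => ?_
    split_ifs <;> simp [Real.exp_log ha]
  have hint : ∫⁻ z, (if z ∈ E then ENNReal.ofReal a else 1) ∂μ ≤
      ENNReal.ofReal (Real.exp ((a - 1) * μ.real E)) := by
    have h1 : ∫⁻ z, (if z ∈ E then ENNReal.ofReal a else 1) ∂μ =
        ENNReal.ofReal a * μ E + μ Eᶜ := by
      rw [← lintegral_add_compl _ hE,
        setLIntegral_congr_fun hE (g := fun _ => ENNReal.ofReal a) fun z hz => by simp_all,
        setLIntegral_congr_fun hE.compl (g := fun _ => 1) fun z hz => by simp_all]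
      simp
    have h2 : μ E = ENNReal.ofReal (μ.real E) := by simp
    have h3 : μ Eᶜ = ENNReal.ofReal (1 - μ.real E) := by
      rw [← probReal_compl_eq_one_sub hE]; simp
    rw [h1, h2, h3, ← ENNReal.ofReal_mul ha.le, ← ENNReal.ofReal_add (by positivity)
      (by linarith [measureReal_le_one (μ := μ) (s := E)])]
    refine ENNReal.ofReal_le_ofReal ?_
    linarith [Real.add_one_le_exp ((a - 1) * μ.real E)]
  have hM := mul_meas_ge_le_lintegral₀ (μ := Measure.pi fun _ : Fin n => μ)
    (f := fun s => ∏ i, (if s i ∈ E then ENNReal.ofReal a else 1))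
    (Finset.measurable_fun_prod _ fun i _ => hf.comp (measurable_pi_apply i)).aemeasurable
    (ENNReal.ofReal (Real.exp (θ * Real.log a)))
  rw [lintegral_pi_prod_eq_pow μ n hf] at hM
  have hset : {s : Fin n → Z | θ * Real.log a ≤ hits E s * Real.log a} ⊆
      {s | ENNReal.ofReal (Real.exp (θ * Real.log a)) ≤
        ∏ i, (if s i ∈ E then ENNReal.ofReal a else 1)} := by
    intro s hs
    rw [Set.mem_ofPred_eq, hprod]
    exact ENNReal.ofReal_le_ofReal (Real.exp_le_exp.2 hs)
  refine (measure_mono hset).trans ?_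
  rw [Real.exp_sub, ENNReal.ofReal_div_of_pos (Real.exp_pos _), ENNReal.le_div_iff_mul_le
    (Or.inl (by simpa using Real.exp_pos _)) (Or.inl ENNReal.ofReal_ne_top), mul_comm]
  refine hM.trans ((pow_le_pow_left' hint n).trans ?_)
  rw [← ENNReal.ofReal_pow (Real.exp_pos _).le, ← Real.exp_nat_mul]

theorem measure_hits_le_of_le (μ : Measure Z) [IsProbabilityMeasure μ] (n : ℕ) {E : Set Z}
    (hE : MeasurableSet E) {ε : ℝ} (h : ε ≤ μ.real E) {a : ℝ} (ha : 0 < a) (ha1 : a < 1) (θ : ℝ) :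
    (Measure.pi fun _ : Fin n => μ) {s | hits E s ≤ θ} ≤
      ENNReal.ofReal (Real.exp (n * ((a - 1) * ε) - θ * Real.log a)) := by
  have hlog := Real.log_neg ha ha1
  refine (measure_mono fun s hs => ?_).trans ((measure_hits_le μ n hE ha θ).trans
    (ENNReal.ofReal_le_ofReal (Real.exp_le_exp.2 ?_)))
  · exact mul_le_mul_of_nonpos_right (Set.mem_ofPred.1 hs) hlog.le
  · have : (a - 1) * μ.real E ≤ (a - 1) * ε := mul_le_mul_of_nonpos_left h (by linarith)
    have := mul_le_mul_of_nonneg_left this (Nat.cast_nonneg (α := ℝ) n)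
    linarith

theorem measure_le_hits_le_of_le (μ : Measure Z) [IsProbabilityMeasure μ] (n : ℕ) {E : Set Z}
    (hE : MeasurableSet E) {ε : ℝ} (h : μ.real E ≤ ε) {a : ℝ} (ha1 : 1 < a) (θ : ℝ) :
    (Measure.pi fun _ : Fin n => μ) {s | θ ≤ hits E s} ≤
      ENNReal.ofReal (Real.exp (n * ((a - 1) * ε) - θ * Real.log a)) := by
  have hlog := Real.log_pos ha1
  refine (measure_mono fun s hs => ?_).trans ((measure_hits_le μ n hE (zero_lt_one.trans ha1) θ).trans
    (ENNReal.ofReal_le_ofReal (Real.exp_le_exp.2 ?_)))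
  · exact mul_le_mul_of_nonneg_right (Set.mem_ofPred.1 hs) hlog.le
  · have : (a - 1) * μ.real E ≤ (a - 1) * ε := mul_le_mul_of_nonneg_left h (by linarith)
    have := mul_le_mul_of_nonneg_left this (Nat.cast_nonneg (α := ℝ) n)
    linarith

theorem half_le_measure_hits (μ : Measure Z) [IsProbabilityMeasure μ] (n : ℕ) {E : Set Z}
    (hE : MeasurableSet E) {ε : ℝ} (h : ε ≤ μ.real E) (hn : 8 ≤ n * ε) :
    1 / 2 ≤ (Measure.pi fun _ : Fin n => μ) {s | n * ε / 4 ≤ hits E s} := by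
  have h1 := measure_hits_le_of_le μ n hE h (a := 1 / 2) (by norm_num) (by norm_num) (n * ε / 4)
  -- The exponent is nε(-1/2 + (log 2)/4), which lies below -log 2 because nε ≥ 8.
  have h2 : Real.exp (n * ((1 / 2 - 1) * ε) - n * ε / 4 * Real.log (1 / 2)) ≤ 1 / 2 := by
    rw [← Real.le_log_iff_exp_le (by norm_num), one_div, Real.log_inv]
    have := Real.log_two_lt_d9
    nlinarith
  have h3 : (Measure.pi fun _ : Fin n => μ) {s | n * ε / 4 ≤ hits E s}ᶜ ≤ 1 / 2 := by
    refine (measure_mono fun s hs => ?_).trans (h1.trans ((ENNReal.ofReal_le_ofReal h2).trans ?_))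
    · exact (not_le.1 (Set.mem_ofPred.not.1 hs)).le
    · rw [ENNReal.ofReal_div_of_pos (by norm_num)]; simp
  have h4 : (1 : ℝ≥0∞) ≤ (Measure.pi fun _ : Fin n => μ) {s | n * ε / 4 ≤ hits E s} +
      (Measure.pi fun _ : Fin n => μ) {s | n * ε / 4 ≤ hits E s}ᶜ := by
    refine le_trans ?_ (measure_union_le _ _)
    simp
  have h5 : (1 : ℝ≥0∞) ≤ (Measure.pi fun _ : Fin n => μ) {s | n * ε / 4 ≤ hits E s} + 1 / 2 :=
    h4.trans (by gcongr)
  have h6 := tsub_le_iff_right.2 h5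
  rwa [one_div, ENNReal.one_sub_inv_two, ← one_div] at h6

end Concentration

/-! ### The double sampling bound -/

section DoubleSampling

open Classical in
/-- Few ways to exchange the two halves of a double sample move all hits of `P` to the second
half. -/
theorem card_swaps_le {n : ℕ} (P : Finset (Fin n × Bool)) (θ : ℝ) :
    ((Finset.univ.filter fun σ : Fin n → Bool => (∀ i, (i, σ i) ∉ P) ∧
      θ ≤ ∑ i, if (i, !σ i) ∈ P then (1 : ℝ) else 0).card : ℝ) ≤ 2 ^ n * Real.exp (-(θ / 2)) := by
  set S := Finset.univ.filter fun σ : Fin n → Bool => (∀ i, (i, σ i) ∉ P) ∧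
      θ ≤ ∑ i, if (i, !σ i) ∈ P then (1 : ℝ) else 0 with hS
  rcases S.eq_empty_or_nonempty with h0 | ⟨σ₀, hσ₀⟩
  · rw [h0]; simp; positivity
  obtain ⟨-, h2⟩ := (Finset.mem_filter.1 hσ₀).2
  set I := Finset.univ.filter fun i => (i, !σ₀ i) ∈ P with hI
  -- One admissible σ₀ fixes all others on I: changing its value at i ∈ I would bring a hit into the
  -- first half. At most 2^(n - |I|) exchanges remain, and |I| ≥ θ.
  have hsub : S ⊆ Fintype.piFinset fun i => if i ∈ I then {σ₀ i} else Finset.univ := by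
    intro σ hσ
    obtain ⟨h3, -⟩ := (Finset.mem_filter.1 hσ).2
    refine Fintype.mem_piFinset.2 fun i => ?_
    split_ifs with hi
    · have hi' := (Finset.mem_filter.1 hi).2
      have := h3 i
      rw [Finset.mem_singleton]
      by_contra hne
      exact this (by rwa [Bool.eq_not.2 hne])
    · exact Finset.mem_univ _
  have hcard : (S.card : ℝ) * 2 ^ I.card ≤ 2 ^ n := by
    have h3 := Finset.card_le_card hsub
    rw [Fintype.card_piFinset, Finset.prod_congr rfl (g := fun i => if i ∈ I then 1 else 2)
      (fun i _ => by split_ifs <;> simp), Finset.prod_ite] at h3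
    simp only [Finset.prod_const, one_pow, one_mul] at h3
    have h4 : (Finset.univ.filter fun i => i ∉ I).card + I.card = n := by
      have := Finset.card_filter_add_card_filter_not (s := (Finset.univ : Finset (Fin n)))
        (fun i => i ∈ I)
      simp only [Finset.filter_univ_mem, Finset.card_univ, Fintype.card_fin] at this
      omega
    have h5 : S.card * 2 ^ I.card ≤ 2 ^ n := by
      rw [show 2 ^ n = 2 ^ (Finset.univ.filter fun i => i ∉ I).card * 2 ^ I.card by
        rw [← pow_add, h4]]
      exact Nat.mul_le_mul_right _ h3
    exact_mod_cast h5
  have hθ : θ ≤ I.card := by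
    refine h2.trans (le_of_eq ?_)
    rw [hI, Finset.card_filter]
    push_cast
    rfl
  have h6 : Real.exp (θ / 2) ≤ 2 ^ I.card := by
    calc Real.exp (θ / 2) ≤ Real.exp (I.card * Real.log 2) := by
          refine Real.exp_le_exp.2 ?_
          have := Real.log_two_gt_d9
          have : (0 : ℝ) ≤ I.card := Nat.cast_nonneg _
          nlinarith
      _ = 2 ^ I.card := by rw [Real.exp_nat_mul, Real.exp_log (by norm_num)]
  rw [Real.exp_neg, ← div_eq_mul_inv, le_div_iff₀ (Real.exp_pos _)]
  exact (mul_le_mul_of_nonneg_left h6 (Nat.cast_nonneg _)).trans hcard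

variable {Z : Type*} [MeasurableSpace Z] {C : Type*} [Finite C]

theorem measurable_hits {Ω : Type*} [MeasurableSpace Ω] {n : ℕ} {E : Ω → Set Z}
    (hE : MeasurableSet {p : Ω × Z | p.2 ∈ E p.1}) {s : Ω → Fin n → Z} (hs : Measurable s) :
    Measurable fun ω => hits (E ω) (s ω) := by
  refine Finset.measurable_fun_sum _ fun i _ => Measurable.ite ?_ measurable_const measurable_const
  exact (measurable_id.prodMk ((measurable_pi_apply i).comp hs)) hE

open Classical in
/-- The double sampling bound of Vapnik and Chervonenkis, for a finite family of data dependent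
events: if the events have at most `G` traces on double samples, then it is unlikely that one of
them has probability greater than `ε` and contains no point of the sample. -/
theorem measure_exists_avoid_le (μ : Measure Z) [IsProbabilityMeasure μ] (n : ℕ)
    (E : C → (Fin n → Z) → Set Z)
    (hE : ∀ c, MeasurableSet {p : (Fin n → Z) × Z | p.2 ∈ E c p.1}) (G : ℕ)
    (hG : ∀ u : Fin n × Bool → Z, (Finset.univ.filter fun P : Finset (Fin n × Bool) =>
      ∃ c s, ∀ j, j ∈ P ↔ u j ∈ E c s).card ≤ G)
    {ε : ℝ} (hn : 8 ≤ n * ε) :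
    (Measure.pi fun _ : Fin n => μ) {s | ∃ c, (∀ i, s i ∉ E c s) ∧ ENNReal.ofReal ε ≤ μ (E c s)} ≤
      ENNReal.ofReal (2 * G * Real.exp (-(n * ε / 8))) := by
  set M := Measure.pi fun _ : Fin n => μ with hM
  set θ := n * ε / 4 with hθ
  let A : Set ((Fin n → Z) × (Fin n → Z)) :=
    {p | ∃ c, (∀ i, p.1 i ∉ E c p.1) ∧ θ ≤ hits (E c p.1) p.2}
  have hsec : ∀ c s, MeasurableSet (E c s) := fun c s => measurable_prodMk_left (hE c)
  have hA : MeasurableSet A := by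
    have : A = ⋃ c, (⋂ i, {p | p.1 i ∉ E c p.1}) ∩ {p | θ ≤ hits (E c p.1) p.2} := by
      ext p; simp [A]
    rw [this]
    refine MeasurableSet.iUnion fun c => (MeasurableSet.iInter fun i => ?_).inter ?_
    · exact ((measurable_fst.prodMk ((measurable_pi_apply i).comp measurable_fst)) (hE c)).compl
    · refine measurableSet_le measurable_const (measurable_hits ?_ measurable_snd)
      exact ((measurable_fst.comp measurable_fst).prodMk measurable_snd) (hE c)
  -- Ghost sample: given a bad first sample, an independent second one hits the same event at least
  -- nε/4 times with probability at least 1/2.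
  have step1 : 1 / 2 * M {s | ∃ c, (∀ i, s i ∉ E c s) ∧ ENNReal.ofReal ε ≤ μ (E c s)} ≤
      (M.prod M) A := by
    rw [Measure.prod_apply hA]
    refine le_trans ?_ (mul_meas_ge_le_lintegral₀
      (measurable_measure_prodMk_left hA).aemeasurable (1 / 2))
    refine mul_le_mul_right (measure_mono ?_) _
    rintro s ⟨c, h1, h2⟩
    have h3 := half_le_measure_hits μ n (hsec c s)
      ((ENNReal.ofReal_le_iff_le_toReal (measure_ne_top _ _)).1 h2) hn
    exact h3.trans (measure_mono fun s' hs' => ⟨c, h1, hs'⟩)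
  set N := Measure.pi fun _ : Fin n => μ.prod μ with hN
  let A' : Set (Fin n → Z × Z) := {v | ((fun i => (v i).1), fun i => (v i).2) ∈ A}
  have hA' : MeasurableSet A' := by
    refine Measurable.prodMk ?_ ?_ hA
    · exact measurable_pi_lambda _ fun i => measurable_fst.comp (measurable_pi_apply i)
    · exact measurable_pi_lambda _ fun i => measurable_snd.comp (measurable_pi_apply i)
  have step2 : (M.prod M) A = N A' :=
    ((measurePreserving_arrowProdEquivProdArrow Z Z (Fin n) (fun _ => μ)
      (fun _ => μ)).measure_preimage hA.nullMeasurableSet).symm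
  -- Exchanging the halves coordinatewise preserves the law, so the measure of `A'` is an average
  -- over the 2^n exchanges, which can be counted for each fixed double sample.
  let sw : (Fin n → Bool) → (Fin n → Z × Z) → Fin n → Z × Z :=
    fun σ v i => if σ i then (v i).swap else v i
  have hsw : ∀ σ, MeasurePreserving (sw σ) N N := by
    intro σ
    refine measurePreserving_pi (fun _ => μ.prod μ) (fun _ => μ.prod μ)
      (f := fun i z => if σ i then z.swap else z) fun i => ?_
    by_cases h : σ i
    · simpa [h] using Measure.measurePreserving_swap
    · simp only [h, Bool.false_eq_true, if_false]; exact MeasurePreserving.id (μ.prod μ)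
  have hcount : ∀ v, ((Finset.univ.filter fun σ => sw σ v ∈ A').card : ℝ) ≤
      G * (2 ^ n * Real.exp (-(θ / 2))) := by
    intro v
    let u : Fin n × Bool → Z := fun j => if j.2 then (v j.1).2 else (v j.1).1
    have hu1 : ∀ σ i, (sw σ v i).1 = u (i, σ i) := by
      intro σ i; by_cases h : σ i <;> simp [sw, u, h]
    have hu2 : ∀ σ i, (sw σ v i).2 = u (i, !σ i) := by
      intro σ i; by_cases h : σ i <;> simp [sw, u, h]
    -- The event is selected from the exchanged first half and changes with σ. Hence traces of `E c
    -- s` for all `s` are collected; the union bound runs over traces and does not involve the size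
    -- of `C`.
    set Ps := Finset.univ.filter fun P : Finset (Fin n × Bool) =>
      ∃ c s, ∀ j, j ∈ P ↔ u j ∈ E c s
    have hsub : (Finset.univ.filter fun σ => sw σ v ∈ A') ⊆ Ps.biUnion fun P =>
        Finset.univ.filter fun σ : Fin n → Bool => (∀ i, (i, σ i) ∉ P) ∧
          θ ≤ ∑ i, if (i, !σ i) ∈ P then (1 : ℝ) else 0 := by
      intro σ hσ
      obtain ⟨c, h1, h2⟩ := (Finset.mem_filter.1 hσ).2
      simp only [hits, hu1, hu2] at h1 h2
      refine Finset.mem_biUnion.2 ⟨Finset.univ.filter fun j =>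
        u j ∈ E c fun i => u (i, σ i), ?_, ?_⟩
      · exact Finset.mem_filter.2 ⟨Finset.mem_univ _, c, fun i => u (i, σ i), fun j => by simp⟩
      · simp only [Finset.mem_filter, Finset.mem_univ, true_and]
        exact ⟨h1, h2⟩
    have h1 := (Finset.card_le_card hsub).trans Finset.card_biUnion_le
    have h2 : ((Finset.univ.filter fun σ => sw σ v ∈ A').card : ℝ) ≤ Ps.card *
        (2 ^ n * Real.exp (-(θ / 2))) := by
      refine (Nat.cast_le.2 h1).trans ?_
      push_cast
      refine (Finset.sum_le_card_nsmul _ _ _ fun P _ => card_swaps_le P θ).trans ?_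
      rw [nsmul_eq_mul]
    refine h2.trans ?_
    gcongr
    exact_mod_cast hG u
  have step3 : (2 : ℝ≥0∞) ^ n * N A' ≤ 2 ^ n * ENNReal.ofReal (G * Real.exp (-(θ / 2))) := by
    calc (2 : ℝ≥0∞) ^ n * N A' = ∑ σ : Fin n → Bool, N (sw σ ⁻¹' A') := by
          simp_rw [fun σ => (hsw σ).measure_preimage hA'.nullMeasurableSet]
          simp
      _ = ∫⁻ v, ∑ σ : Fin n → Bool, (sw σ ⁻¹' A').indicator 1 v ∂N := by
          rw [lintegral_finsetSum _ fun σ _ =>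
            measurable_one.indicator ((hsw σ).measurable hA')]
          exact Finset.sum_congr rfl fun σ _ =>
            (lintegral_indicator_one ((hsw σ).measurable hA')).symm
      _ ≤ ∫⁻ _, ENNReal.ofReal (G * (2 ^ n * Real.exp (-(θ / 2)))) ∂N := by
          refine lintegral_mono fun v => ?_
          refine le_trans (le_of_eq ?_) (ENNReal.ofReal_le_ofReal (hcount v))
          simp only [Set.indicator_apply, Set.mem_preimage, Pi.one_apply]
          rw [ENNReal.ofReal_natCast, Finset.card_filter]
          push_cast
          rfl
      _ = 2 ^ n * ENNReal.ofReal (G * Real.exp (-(θ / 2))) := by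
          rw [lintegral_const, measure_univ, mul_one, mul_left_comm,
            ENNReal.ofReal_mul (by positivity), ENNReal.ofReal_pow (by norm_num)]
          simp
  have step4 : N A' ≤ ENNReal.ofReal (G * Real.exp (-(θ / 2))) :=
    (ENNReal.mul_le_mul_iff_right (by simp) (by simp)).1 step3
  have h5 := (step1.trans step2.le).trans step4
  rw [one_div, ← ENNReal.div_eq_inv_mul, ENNReal.div_le_iff_le_mul (by simp) (by simp)] at h5
  refine h5.trans (le_of_eq ?_)
  rw [show -(n * ε / 8) = -(θ / 2) by rw [hθ]; ring, mul_assoc,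
    ENNReal.ofReal_mul (p := 2) (by norm_num), mul_comm]
  simp

end DoubleSampling

/-! ### Consistent classifiers selected from the sample -/

section Consistent

/-- The double sampling bound for classifiers of a class `𝓖` with few traces that are selected
from the sample. -/
theorem measure_exists_consistent_inaccurate_le {X Z C : Type*} [MeasurableSpace Z] [Finite C]
    (μ : Measure Z) [IsProbabilityMeasure μ] (n : ℕ) (pt : Z → X) (𝓖 : Set (X → Bool))
    (g : C → (Fin n → Z) → X → Bool) (hg : ∀ c s, g c s ∈ 𝓖) (hstar : X → Bool)
    (hE : ∀ c, MeasurableSet {p : (Fin n → Z) × Z | g c p.1 (pt p.2) ≠ hstar (pt p.2)}) (G : ℕ)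
    (hG : ∀ u : Fin n × Bool → X, (traces 𝓖 u).card ≤ G) {ε : ℝ} (hn : 8 ≤ n * ε) :
    (Measure.pi fun _ : Fin n => μ) {s | ∃ c, (∀ i, g c s (pt (s i)) = hstar (pt (s i))) ∧
        ENNReal.ofReal ε ≤ μ {z | g c s (pt z) ≠ hstar (pt z)}} ≤
      ENNReal.ofReal (2 * G * Real.exp (-(n * ε / 8))) := by
  classical
  have h := measure_exists_avoid_le μ n (fun c s => {z | g c s (pt z) ≠ hstar (pt z)}) hE G
    (fun u => ?_) hn
  · refine le_trans (measure_mono ?_) h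
    rintro s ⟨c, h1, h2⟩
    exact ⟨c, fun i => by simp [h1 i], h2⟩
  -- Every error pattern is the symmetric difference of a trace of `𝓖` with the trace `Q` of the
  -- target, so there are no more error patterns than traces.
  · let Q : Finset (Fin n × Bool) := Finset.univ.filter fun j => hstar (pt (u j)) = true
    refine (Finset.card_le_card (t := (traces 𝓖 fun j => pt (u j)).image (symmDiff · Q))
      fun P hP => ?_).trans (Finset.card_image_le.trans (hG _))
    obtain ⟨c, s, hP⟩ := (Finset.mem_filter.1 hP).2
    refine Finset.mem_image.2 ⟨symmDiff P Q, mem_traces.2 ⟨g c s, hg c s, fun j => ?_⟩,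
      symmDiff_symmDiff_cancel_right _ _⟩
    have hQ : j ∈ Q ↔ hstar (pt (u j)) = true := by simp [Q]
    rw [Finset.mem_symmDiff, hQ, hP j, Set.mem_ofPred_eq]
    cases g c s (pt (u j)) <;> cases hstar (pt (u j)) <;> simp

end Consistent

/-! ### Resampling and weak learning -/

section WeakLearner

variable {k : ℕ} {X : Type u}

/-- The distribution on indices that is proportional to the weights `w`. -/
noncomputable def weightMeasure {m : ℕ} (w : Fin m → ℝ≥0) : Measure (Fin m) :=
  ∑ l, ((w l : ℝ≥0∞) / ∑ l', (w l' : ℝ≥0∞)) • Measure.dirac l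

theorem lintegral_weightMeasure {m : ℕ} (w : Fin m → ℝ≥0) (f : Fin m → ℝ≥0∞) :
    ∫⁻ l, f l ∂(weightMeasure w) = ∑ l, ((w l : ℝ≥0∞) / ∑ l', (w l' : ℝ≥0∞)) * f l := by
  simp [weightMeasure, lintegral_finsetSum_measure]

theorem sum_coe_ne_zero {m : ℕ} (hm : 0 < m) {w : Fin m → ℝ≥0} (hw : ∀ l, 0 < w l) :
    ∑ l, (w l : ℝ≥0∞) ≠ 0 := by
  have := hw ⟨0, hm⟩
  simpa using ⟨_, this.ne'⟩

theorem isProbabilityMeasure_weightMeasure {m : ℕ} (hm : 0 < m) {w : Fin m → ℝ≥0}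
    (hw : ∀ l, 0 < w l) : IsProbabilityMeasure (weightMeasure w) := by
  refine ⟨?_⟩
  rw [← lintegral_one, lintegral_weightMeasure]
  simp only [mul_one, div_eq_mul_inv]
  rw [← Finset.sum_mul, ENNReal.mul_inv_cancel (sum_coe_ne_zero hm hw)]
  exact ENNReal.sum_ne_top.2 fun l _ => ENNReal.coe_ne_top

/-- The total weight of the chosen reservoir cancels against the normalization of the second choice.
Positive weights keep this total nonzero for every reservoir that contains a point; empty reservoirs
contribute nothing. -/
theorem hasLaw_resample [MeasurableSpace X] (D : Fin k → Measure X) (hstar : X → Bool) {m : ℕ}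
    (S : Fin m → Fin k × (X × Bool)) {w : Fin m → ℝ≥0} (hw : ∀ l, 0 < w l) :
    Prog.HasLaw D hstar (resample S w) (weightMeasure w) id := by
  intro f _
  simp only [id, lintegral_weightMeasure, resample, Prog.expect]
  have h0 : ∑ i : Fin k, ((∑ l, if (S l).1 = i then w l else 0 : ℝ≥0) : ℝ≥0∞) =
      ∑ l, (w l : ℝ≥0∞) := by
    simp only [ENNReal.ofNNReal_finsetSum]
    rw [Finset.sum_comm]
    refine Finset.sum_congr rfl fun l _ => ?_
    rw [Finset.sum_eq_single (S l).1 (fun i _ hi => by simp [Ne.symm hi]) (by simp), if_pos rfl]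
  rw [h0]
  simp only [Finset.mul_sum, ← mul_assoc]
  rw [Finset.sum_comm]
  simp only [← Finset.sum_mul]
  refine Finset.sum_congr rfl fun l _ => ?_
  congr 1
  rw [Finset.sum_eq_single (S l).1]
  · have hpos : (0 : ℝ≥0) < ∑ l', if (S l').1 = (S l).1 then w l' else 0 :=
      Finset.sum_pos' (fun _ _ => zero_le) ⟨l, Finset.mem_univ _, by simpa using hw l⟩
    rw [if_pos rfl]
    have : (∑ l', ((if (S l').1 = (S l).1 then w l' else 0 : ℝ≥0) : ℝ≥0∞)) =
        ((∑ l', if (S l').1 = (S l).1 then w l' else 0 : ℝ≥0) : ℝ≥0∞) := by push_cast; rfl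
    rw [this, div_eq_mul_inv, div_eq_mul_inv, mul_comm (_ : ℝ≥0∞) (_)⁻¹, mul_assoc,
      mul_comm (w l : ℝ≥0∞), ← mul_assoc (_ : ℝ≥0∞) (_)⁻¹, ENNReal.mul_inv_cancel
      (by exact_mod_cast hpos.ne') ENNReal.coe_ne_top, one_mul, mul_comm, div_eq_mul_inv]
  · intro i _ hi
    simp [Ne.symm hi]
  · simp

theorem weightMeasure_real_ne {m : ℕ} (S : Fin m → Fin k × (X × Bool)) (w : Fin m → ℝ≥0)
    (h : X → Bool) (hm : 0 < m) (hw : ∀ l, 0 < w l) :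
    weightMeasure w {l | h (S l).2.1 ≠ (S l).2.2} = (weightedError S w h : ℝ≥0∞) := by
  have hne : ∑ l, w l ≠ 0 := by
    have := sum_coe_ne_zero hm hw
    exact_mod_cast this
  rw [← lintegral_indicator_one MeasurableSet.of_discrete, lintegral_weightMeasure, weightedError,
    ENNReal.coe_div hne]
  push_cast
  simp only [div_eq_mul_inv]
  rw [Finset.sum_mul]
  refine Finset.sum_congr rfl fun l _ => ?_
  by_cases hl : h (S l).2.1 = (S l).2.2 <;> simp [hl]

/-- A consistent learner that receives `512 d` resampled points is a weak learner, except with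
small probability. -/
theorem measure_weightedError_le {H : Set (X → Bool)} {d : ℕ} (hd : 0 < d) (hH : vcDim H ≤ d)
    {A : Learner X} (hA : A.IsConsistent H) {hstar : X → Bool} (hs : hstar ∈ H) {m : ℕ}
    (hm : 0 < m) {S : Fin m → Fin k × (X × Bool)} (hS : ∀ l, (S l).2.2 = hstar (S l).2.1)
    {w : Fin m → ℝ≥0} (hw : ∀ l, 0 < w l) :
    (Measure.pi fun _ : Fin (512 * d) => weightMeasure w)
      {s | 1 / 4 ≤ weightedError S w (A (512 * d) fun q => (S (s q)).2)} ≤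
        ENNReal.ofReal (1 / 40) := by
  have := isProbabilityMeasure_weightMeasure hm hw
  have hd1 : (1 : ℝ) ≤ d := by exact_mod_cast hd
  have hcons := fun s : Fin (512 * d) → Fin m =>
    hA (512 * d) (fun q => (S (s q)).2) ⟨hstar, hs, fun q => (hS _).symm⟩
  have h := measure_exists_consistent_inaccurate_le (C := Unit) (weightMeasure w) (512 * d)
    (fun l => (S l).2.1) H (fun _ s => A (512 * d) fun q => (S (s q)).2) (fun _ s => (hcons s).1)
    hstar (fun _ => MeasurableSet.of_discrete) _ (fun u => card_traces_le hH u) (ε := 1 / 4)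
    (by push_cast; linarith)
  refine (measure_mono fun s hs' => ?_).trans (h.trans (ENNReal.ofReal_le_ofReal ?_))
  · refine ⟨(), fun i => ((hcons s).2 i).trans (hS _), ?_⟩
    simp only [← hS]
    rw [weightMeasure_real_ne S w _ hm hw, show ENNReal.ofReal (1 / 4) = ((1 / 4 : ℝ≥0) : ℝ≥0∞) by
      rw [ENNReal.ofReal, Real.toNNReal_div (by norm_num)]; simp]
    exact ENNReal.coe_le_coe.2 hs'
  · have hc : Fintype.card (Fin (512 * d) × Bool) = 1024 * d := by
      simp; ring
    have h1 := sum_choose_le_exp (N := 1024 * d) hd (by omega)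
    rw [hc]
    push_cast at h1 ⊢
    have h2 : Real.exp (-(512 * d * (1 / 4) / 8)) = Real.exp (-16) ^ d := by
      rw [← Real.exp_nat_mul]; congr 1; ring
    -- The double sample has 1024 d points, so the bound is 2 (1024 e · e^(-16))^d, and 1024 e^(-15)
    -- ≤ 1/80.
    have h3 : Real.exp 1 * (1024 * d / d) * Real.exp (-16) ≤ 1 / 80 := by
      rw [mul_div_assoc, div_self (by positivity), mul_one, mul_right_comm, ← Real.exp_add,
        show (1 : ℝ) + -16 = -(15 : ℕ) by norm_num, Real.exp_neg, ← mul_one ((15 : ℕ) : ℝ),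
        Real.exp_nat_mul]
      have h17 : (2.7 : ℝ) ^ 15 ≤ Real.exp 1 ^ 15 :=
        pow_le_pow_left₀ (by norm_num) (by linarith [Real.exp_one_gt_d9]) _
      rw [inv_mul_le_iff₀ (by positivity)]
      norm_num at h17 ⊢
      linarith
    have h4 : (Real.exp 1 * (1024 * d / d) * Real.exp (-16)) ^ d ≤ 1 / 80 :=
      (pow_le_of_le_one (by positivity) (h3.trans (by norm_num)) hd.ne').trans h3
    rw [h2, mul_assoc]
    have h5 := mul_le_mul_of_nonneg_right h1 (show 0 ≤ Real.exp (-16) ^ d by positivity)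
    rw [← mul_pow] at h5
    linarith

end WeakLearner

/-! ### Decay of the exponential loss -/

section AdaBoost

variable {k : ℕ} {X : Type u}

/-- The exponential loss of a vote `F` at a labelled point. -/
noncomputable def expLoss (F : X → ℝ) (z : X × Bool) : ℝ :=
  Real.exp (if z.2 = true then -F z.1 else F z.1)

/-- This is the ratio of successive exponential losses in AdaBoost. With r = √(e/(1-e)) it equals
2r/(1+r²) = 2√(e(1-e)), which is √3/2 < 7/8 at e = 1/4. The bound 1 holds even for e > 1/2, so a bad
round does no harm. -/
theorem adaBoost_factor_le_one {e : ℝ} (he0 : 0 < e) (he1 : e < 1) :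
    (1 - e) * √(e / (1 - e)) + e * (√(e / (1 - e)))⁻¹ ≤ 1 ∧
      (e ≤ 1 / 4 → (1 - e) * √(e / (1 - e)) + e * (√(e / (1 - e)))⁻¹ ≤ 7 / 8) := by
  have h1 : 0 < 1 - e := by linarith
  set r := √(e / (1 - e)) with hr
  have hr0 : 0 < r := Real.sqrt_pos.2 (by positivity)
  have hsq : r ^ 2 * (1 - e) = e := by
    rw [hr, Real.sq_sqrt (by positivity)]; field_simp
  have e1 : e = r ^ 2 / (1 + r ^ 2) := by
    rw [eq_div_iff (by positivity)]; linarith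
  have e2 : 1 - e = 1 / (1 + r ^ 2) := by
    rw [e1]; field_simp; ring
  have e3 : (1 - e) * r + e * r⁻¹ = 2 * r / (1 + r ^ 2) := by
    rw [e2, e1]; field_simp; ring
  rw [e3]
  refine ⟨?_, fun h => ?_⟩
  · rw [div_le_one (by positivity)]
    nlinarith [sq_nonneg (r - 1)]
  · have h3 : r ^ 2 ≤ 1 / 3 := by
      have : r ^ 2 * (3 / 4) ≤ r ^ 2 * (1 - e) := by gcongr; linarith
      linarith
    have h4 : r ≤ 0.58 := abs_le_of_sq_le_sq' (by nlinarith) (by norm_num) |>.2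
    rw [div_le_iff₀ (by positivity)]
    nlinarith

variable [MeasurableSpace X]

/-- AdaBoost with a weak learner that errs with small probability fits the reservoirs. -/
theorem le_expect_boostRounds {H : Set (X → Bool)} {d : ℕ} (hd : 0 < d) (hH : vcDim H ≤ d)
    {A : Learner X} (hA : A.IsConsistent H) {hstar : X → Bool} (hs : hstar ∈ H)
    (D : Fin k → Measure X) {m : ℕ} (hm : 0 < m) {S : Fin m → Fin k × (X × Bool)}
    (hS : ∀ l, (S l).2.2 = hstar (S l).2.1) (T : ℕ) (w : Fin m → ℝ≥0) (F : X → ℝ) {B : ℝ}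
    (hB : 0 < B) (hw : ∀ l, expLoss F (S l).2 = w l * B) :
    1 - ENNReal.ofReal ((9 / 10) ^ T * ∑ l, expLoss F (S l).2) ≤
      (boostRounds A (512 * d) S T w F).expect D hstar
        ({g | ∀ l, g (S l).2.1 = (S l).2.2}.indicator 1) := by
  -- The invariant `hw` says that the weights are proportional to the exponential losses; the factor
  -- B changes from round to round.
  induction T generalizing w F B with
  | zero =>
    simp only [boostRounds, Prog.expect, pow_zero, one_mul]
    by_cases h : ∀ l, decide (0 ≤ F (S l).2.1) = (S l).2.2
    · rw [Set.indicator_of_mem (by exact h)]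
      simp
    · push Not at h
      obtain ⟨l, hl⟩ := h
      -- A single misclassified point has loss at least 1, so the total loss dominates the indicator
      -- of failure.
      have h1 : 1 ≤ expLoss F (S l).2 := by
        rw [expLoss, Real.one_le_exp_iff]
        by_cases hy : (S l).2.2 = true
        · simp only [hy, if_true] at hl ⊢
          have : ¬ 0 ≤ F (S l).2.1 := by simpa using hl
          linarith
        · simp only [hy] at hl ⊢
          simpa using hl
      have h2 : 1 ≤ ∑ l, expLoss F (S l).2 :=
        h1.trans (Finset.single_le_sum (f := fun l => expLoss F (S l).2)
          (fun _ _ => (Real.exp_pos _).le) (Finset.mem_univ l))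
      rw [tsub_eq_zero_of_le (by simpa using ENNReal.ofReal_le_ofReal h2)]
      exact zero_le
  | succ T ih =>
    set Φ := ∑ l, expLoss F (S l).2 with hΦ
    have hΦ0 : 0 ≤ Φ := Finset.sum_nonneg fun _ _ => (Real.exp_pos _).le
    have hwpos : ∀ l, 0 < w l := by
      intro l
      have : 0 < w l * B := hw l ▸ Real.exp_pos _
      exact_mod_cast pos_of_mul_pos_left this hB.le
    have hprob := isProbabilityMeasure_weightMeasure hm hwpos
    set M := Measure.pi fun _ : Fin (512 * d) => weightMeasure w with hM
    let bad : Set (Fin (512 * d) → Fin m) :=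
      {s | 1 / 4 ≤ weightedError S w (A (512 * d) fun q => (S (s q)).2)}
    have hbad : M bad ≤ ENNReal.ofReal (1 / 40) := measure_weightedError_le hd hH hA hs hm hS hwpos
    -- The factor of the round is at most 7/8 outside `bad` and at most 1 on it; integrating gives
    -- 7/8 + 1/40 = 9/10.
    let loss : (Fin (512 * d) → Fin m) → ℝ≥0∞ := fun s =>
      ENNReal.ofReal ((9 / 10) ^ T * Φ) * (ENNReal.ofReal (7 / 8) + bad.indicator 1 s)
    rw [boostRounds, Prog.expect_bind,
      (hasLaw_resample D hstar S hwpos).each (512 * d) _ Measurable.of_discrete]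
    have hstep : ∀ s : Fin (512 * d) → Fin m, 1 - loss s ≤ Prog.expect D hstar
        (if weightedError S w (A (512 * d) fun q => (S (s q)).2) = 0 then
          Prog.ret (A (512 * d) fun q => (S (s q)).2)
        else boostRounds A (512 * d) S T
          (fun l => if A (512 * d) (fun q => (S (s q)).2) (S l).2.1 = (S l).2.2 then
            w l * (weightedError S w (A (512 * d) fun q => (S (s q)).2) /
              (1 - weightedError S w (A (512 * d) fun q => (S (s q)).2))) else w l)
          (fun x => F x + Real.log (1 / ((weightedError S w (A (512 * d) fun q => (S (s q)).2) /
              (1 - weightedError S w (A (512 * d) fun q => (S (s q)).2)) : ℝ≥0) : ℝ)) *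
                ((if A (512 * d) (fun q => (S (s q)).2) x = true then 1 else 0) - 1 / 2)))
        ({g | ∀ l, g (S l).2.1 = (S l).2.2}.indicator 1) := by
      intro s
      have hcons := hA (512 * d) (fun q => (S (s q)).2) ⟨hstar, hs, fun q => (hS _).symm⟩
      set h := A (512 * d) fun q => (S (s q)).2 with hh
      set e := weightedError S w h with he
      have hW : 0 < ∑ l, w l := by
        have := sum_coe_ne_zero hm hwpos
        exact pos_iff_ne_zero.2 (by exact_mod_cast this)
      have heW : e * ∑ l, w l = ∑ l, if h (S l).2.1 = (S l).2.2 then 0 else w l := by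
        rw [he, weightedError, div_mul_cancel₀ _ hW.ne']
      split_ifs with h0
      · have hc : ∀ l, h (S l).2.1 = (S l).2.2 := by
          intro l
          rw [h0, zero_mul, eq_comm, Finset.sum_eq_zero_iff] at heW
          by_contra hl
          have := heW l (Finset.mem_univ _)
          rw [if_neg hl] at this
          exact (hwpos l).ne' this
        simp only [Prog.expect]
        rw [Set.indicator_of_mem (by exact hc)]
        simp
      · have he0 : 0 < e := pos_iff_ne_zero.2 h0
        -- The hypothesis fits the resampled points, and there is at least one since 512 d > 0. Thus
        -- the truncated difference 1 - e in the multiplier is a genuine positive one.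
        have he1 : e < 1 := by
          rw [he, weightedError, div_lt_one hW]
          refine Finset.sum_lt_sum (fun l _ => by split_ifs <;> simp)
            ⟨s ⟨0, by omega⟩, Finset.mem_univ _, ?_⟩
          rw [if_pos (hcons.2 ⟨0, by omega⟩)]
          exact hwpos _
        have heR0 : (0 : ℝ) < e := he0
        have heR1 : (e : ℝ) < 1 := by exact_mod_cast he1
        have hbR : ((e / (1 - e) : ℝ≥0) : ℝ) = e / (1 - e) := by
          rw [NNReal.coe_div, NNReal.coe_sub he1.le, NNReal.coe_one]
        have hsub : (0 : ℝ) < 1 - e := by linarith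
        set r := √((e : ℝ) / (1 - e)) with hr
        have hr0 : 0 < r := Real.sqrt_pos.2 (by positivity)
        have hr2 : (e : ℝ) / (1 - e) = r * r := by rw [hr, Real.mul_self_sqrt (by positivity)]
        have hloss : ∀ l, expLoss (fun x => F x + Real.log (1 / ((e / (1 - e) : ℝ≥0) : ℝ)) *
            ((if h x = true then 1 else 0) - 1 / 2)) (S l).2 =
            expLoss F (S l).2 * if h (S l).2.1 = (S l).2.2 then r else r⁻¹ := by
          intro l
          -- Half of all votes is subtracted in `F`, so the round changes it by ±log r, and the
          -- losses by the factors r and r⁻¹.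
          have hlog : Real.log (1 / ((e / (1 - e) : ℝ≥0) : ℝ)) = -(2 * Real.log r) := by
            rw [hbR, hr2, one_div, Real.log_inv, Real.log_mul hr0.ne' hr0.ne']; ring
          have : (if h (S l).2.1 = (S l).2.2 then r else r⁻¹) =
              Real.exp (if h (S l).2.1 = (S l).2.2 then Real.log r else -Real.log r) := by
            split_ifs
            · rw [Real.exp_log hr0]
            · rw [Real.exp_neg, Real.exp_log hr0]
          rw [this, expLoss, expLoss, ← Real.exp_add, hlog]
          congr 1
          rcases Bool.eq_false_or_eq_true (S l).2.2 with hy | hy <;>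
            rcases Bool.eq_false_or_eq_true (h (S l).2.1) with hx | hx <;>
            simp only [hx, hy, if_true, Bool.false_eq_true, Bool.true_eq_false, if_false] <;> ring
        have hsum : ∑ l, expLoss (fun x => F x + Real.log (1 / ((e / (1 - e) : ℝ≥0) : ℝ)) *
            ((if h x = true then 1 else 0) - 1 / 2)) (S l).2 =
            Φ * ((1 - e) * r + e * r⁻¹) := by
          have hwrong : ∑ l, (if h (S l).2.1 = (S l).2.2 then 0 else expLoss F (S l).2) =
              e * Φ := by
            have hR : (e : ℝ) * ∑ l, (w l : ℝ) =
                ∑ l, if h (S l).2.1 = (S l).2.2 then 0 else (w l : ℝ) := by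
              have := congrArg (fun x : ℝ≥0 => (x : ℝ)) heW
              push_cast at this
              rw [this]
              exact Finset.sum_congr rfl fun l _ => by split_ifs <;> simp
            simp only [hΦ, hw]
            rw [← Finset.sum_mul, ← mul_assoc, hR, Finset.sum_mul]
            exact Finset.sum_congr rfl fun l _ => by split_ifs <;> simp
          have hpt : ∀ l, expLoss F (S l).2 * (if h (S l).2.1 = (S l).2.2 then r else r⁻¹) =
              r * expLoss F (S l).2 + (r⁻¹ - r) *
                (if h (S l).2.1 = (S l).2.2 then 0 else expLoss F (S l).2) := by
            intro l; split_ifs <;> ring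
          simp only [hloss, hpt]
          rw [Finset.sum_add_distrib, ← Finset.mul_sum, ← Finset.mul_sum, hwrong, ← hΦ]
          ring
        obtain ⟨hf1, hf2⟩ := adaBoost_factor_le_one heR0 heR1
        -- At correct points the loss gains r and the weight r²; at wrong points the loss gains r⁻¹
        -- and the weight is unchanged. In both cases their ratio gains r⁻¹.
        refine le_trans ?_ (ih _ _ (B := B * r⁻¹) (by positivity) fun l => ?_)
        · refine tsub_le_tsub_left ?_ _
          rw [hsum, ← mul_assoc, ENNReal.ofReal_mul (by positivity)]
          refine mul_le_mul_right ?_ _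
          by_cases hsb : s ∈ bad
          · rw [Set.indicator_of_mem hsb]
            exact (ENNReal.ofReal_le_ofReal hf1).trans (by simp)
          · have : (e : ℝ) ≤ 1 / 4 := by
              have := (not_le.1 (Set.mem_ofPred.not.1 hsb)).le
              have h4 : (e : ℝ) ≤ ((1 / 4 : ℝ≥0) : ℝ) := NNReal.coe_le_coe.2 this
              simpa using h4
            exact (ENNReal.ofReal_le_ofReal (hf2 this)).trans le_self_add
        · rw [hloss, hw l]
          split_ifs
          · rw [NNReal.coe_mul, hbR, hr2]
            field_simp
          · ring
    refine le_trans ?_ (lintegral_mono hstep)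
    have h1 : (1 : ℝ≥0∞) ≤ ∫⁻ s, (1 - loss s) ∂M + ∫⁻ s, loss s ∂M := by
      rw [← lintegral_add_left Measurable.of_discrete]
      calc (1 : ℝ≥0∞) = ∫⁻ _, 1 ∂M := by simp
        _ ≤ _ := lintegral_mono fun s => le_tsub_add
    refine tsub_le_iff_right.2 (h1.trans ?_)
    gcongr
    rw [lintegral_const_mul _ Measurable.of_discrete, lintegral_add_left measurable_const,
      lintegral_indicator_one MeasurableSet.of_discrete, lintegral_const, measure_univ, mul_one,
      pow_succ, mul_right_comm, ENNReal.ofReal_mul (q := 9 / 10) (by positivity)]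
    refine mul_le_mul_right ((add_le_add_right hbad _).trans (le_of_eq ?_)) _
    rw [← ENNReal.ofReal_add (by norm_num) (by norm_num)]
    norm_num

end AdaBoost

/-! ### Boosting with prescribed resampled indices -/

section BoostOut

variable {k : ℕ} {X : Type u}

/-- The output of the boosting rounds in which the points with the indices `c t q` are
resampled. -/
noncomputable def boostOut (A : Learner X) (n : ℕ) {m : ℕ} (S : Fin m → Fin k × (X × Bool)) :
    (T : ℕ) → (Fin T → Fin n → Fin m) → (Fin m → ℝ≥0) → (X → ℝ) → X → Bool
  | 0, _, _, F => fun x => decide (0 ≤ F x)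
  | T + 1, c, w, F =>
    let h : X → Bool := A n fun q => (S (c 0 q)).2
    let e : ℝ≥0 := weightedError S w h
    let b : ℝ≥0 := e / (1 - e)
    if e = 0 then h
    else boostOut A n S T (fun t => c t.succ)
      (fun l => if h (S l).2.1 = (S l).2.2 then w l * b else w l)
      (fun x => F x + Real.log (1 / (b : ℝ)) * ((if h x = true then 1 else 0) - 1 / 2))

/-- Only classifiers of the form `boostOut` are ever returned, so it suffices to compare `f` and `g`
there. This converts fitting the reservoirs into accuracy. -/
theorem expect_boostRounds_le_of_boostOut [MeasurableSpace X] (D : Fin k → Measure X)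
    (hstar : X → Bool) (A : Learner X) (n : ℕ) {m : ℕ} (S : Fin m → Fin k × (X × Bool)) (T : ℕ)
    (w : Fin m → ℝ≥0) (F : X → ℝ) {f g : (X → Bool) → ℝ≥0∞}
    (h : ∀ c, f (boostOut A n S T c w F) ≤ g (boostOut A n S T c w F)) :
    (boostRounds A n S T w F).expect D hstar f ≤ (boostRounds A n S T w F).expect D hstar g := by
  induction T generalizing w F with
  | zero => exact h Fin.elim0
  | succ T ih =>
    simp only [boostRounds, Prog.expect_bind]
    refine Prog.expect_mono _ fun idx => ?_
    split_ifs with h0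
    · have := h (Fin.cons idx fun _ => idx)
      simpa [boostOut, h0, Prog.expect] using this
    · refine ih _ _ fun c => ?_
      have := h (Fin.cons idx c)
      simpa only [boostOut, Fin.cons_zero, h0, if_false, Fin.cons_succ] using this

/-- The coefficient a₀ accounts for early stopping: a round with e = 0 discards all earlier votes,
which means a₀ = 0. -/
theorem exists_boostOut_eq {H : Set (X → Bool)} {A : Learner X} (hA : A.IsConsistent H)
    {hstar : X → Bool} (hs : hstar ∈ H) (n : ℕ) {m : ℕ} {S : Fin m → Fin k × (X × Bool)}
    (hS : ∀ l, (S l).2.2 = hstar (S l).2.1) (T : ℕ) (c : Fin T → Fin n → Fin m)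
    (w : Fin m → ℝ≥0) (F : X → ℝ) :
    ∃ (a₀ : ℝ) (h : Fin T → X → Bool) (a : Fin T → ℝ), (∀ t, h t ∈ H) ∧
      ∀ x, boostOut A n S T c w F x = true ↔
        0 ≤ a₀ * F x + ∑ t, a t * ((if h t x = true then 1 else 0) - 1 / 2) := by
  induction T generalizing w F with
  | zero => exact ⟨1, Fin.elim0, Fin.elim0, fun t => t.elim0, fun x => by simp [boostOut]⟩
  | succ T ih =>
    have hh := (hA n (fun q => (S (c 0 q)).2) ⟨hstar, hs, fun q => (hS _).symm⟩).1
    simp only [boostOut]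
    split_ifs with h0
    -- The returned hypothesis is written as one vote of weight 1 padded with votes of weight 0, so
    -- that the number of voters stays the same.
    · refine ⟨0, fun _ => A n fun q => (S (c 0 q)).2, Fin.cons 1 0, fun _ => hh, fun x => ?_⟩
      rw [Fin.sum_univ_succ]
      simp only [Fin.cons_zero, Fin.cons_succ, Pi.zero_apply, zero_mul, Finset.sum_const_zero]
      by_cases hx : A n (fun q => (S (c 0 q)).2) x = true <;> simp only [hx] <;> norm_num
    · set e := weightedError S w (A n fun q => (S (c 0 q)).2)
      obtain ⟨a₀, h, a, h1, h2⟩ := ih (fun t => c t.succ) _ _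
      refine ⟨a₀, Fin.cons (A n fun q => (S (c 0 q)).2) h,
        Fin.cons (a₀ * Real.log (1 / ((e / (1 - e) : ℝ≥0) : ℝ))) a, fun t => Fin.cases hh h1 t, fun x => (h2 x).trans ?_⟩
      rw [Fin.sum_univ_succ]
      simp only [Fin.cons_zero, Fin.cons_succ]
      rw [mul_add, mul_assoc, add_assoc]

theorem boostOut_mem_majorityClass {H : Set (X → Bool)} {A : Learner X} (hA : A.IsConsistent H)
    {hstar : X → Bool} (hs : hstar ∈ H) (n : ℕ) {m : ℕ} {S : Fin m → Fin k × (X × Bool)}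
    (hS : ∀ l, (S l).2.2 = hstar (S l).2.1) (T : ℕ) (c : Fin T → Fin n → Fin m)
    (w : Fin m → ℝ≥0) : boostOut A n S T c w (fun _ => 0) ∈ majorityClass H T := by
  obtain ⟨a₀, h, a, h1, h2⟩ := exists_boostOut_eq hA hs n hS T c w fun _ => 0
  exact ⟨h, a, h1, fun x => by simpa using h2 x⟩

variable [MeasurableSpace X]

theorem measurable_boostOut {A : Learner X} (hA : A.IsMeasurable) (n : ℕ) {m : ℕ} {Ω : Type*}
    [MeasurableSpace Ω] {S : Ω → Fin m → Fin k × (X × Bool)} (hS : Measurable S) (T : ℕ)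
    (c : Fin T → Fin n → Fin m) {w : Ω → Fin m → ℝ≥0} (hw : Measurable w) {F : Ω → X → ℝ}
    (hF : Measurable fun p : Ω × X => F p.1 p.2) :
    Measurable fun p : Ω × X => boostOut A n (S p.1) T c (w p.1) (F p.1) p.2 := by
  induction T generalizing w F with
  | zero =>
    exact measurable_to_bool (by
      have : MeasurableSet {p : Ω × X | 0 ≤ F p.1 p.2} := measurableSet_le measurable_const hF
      convert this using 1
      ext p
      simp [boostOut])
  | succ T ih =>
    have hSl : ∀ l, Measurable fun ω => S ω l := fun l => (measurable_pi_apply l).comp hS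
    have hh : Measurable fun p : Ω × X => A n (fun q => (S p.1 (c 0 q)).2) p.2 :=
      (hA n).comp ((measurable_pi_lambda _ fun q =>
        ((hSl (c 0 q)).snd.comp measurable_fst)).prodMk measurable_snd)
    have hcorrect : ∀ l, MeasurableSet
        {ω | A n (fun q => (S ω (c 0 q)).2) (S ω l).2.1 = (S ω l).2.2} := fun l =>
      measurableSet_eq_fun (hh.comp (measurable_id.prodMk (hSl l).snd.fst)) (hSl l).snd.snd
    have hwl : ∀ l, Measurable fun ω => w ω l := fun l => (measurable_pi_apply l).comp hw
    have he : Measurable fun ω => weightedError (S ω) (w ω) (A n fun q => (S ω (c 0 q)).2) :=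
      (Finset.measurable_fun_sum _ fun l _ =>
        Measurable.ite (hcorrect l) measurable_const (hwl l)).div
        (Finset.measurable_fun_sum _ fun l _ => hwl l)
    have hb : Measurable fun ω => weightedError (S ω) (w ω) (A n fun q => (S ω (c 0 q)).2) /
        (1 - weightedError (S ω) (w ω) (A n fun q => (S ω (c 0 q)).2)) :=
      he.div (measurable_const.sub he)
    have hih := ih (fun t => c t.succ)
      (w := fun ω l => if A n (fun q => (S ω (c 0 q)).2) (S ω l).2.1 = (S ω l).2.2 then
        w ω l * (weightedError (S ω) (w ω) (A n fun q => (S ω (c 0 q)).2) /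
          (1 - weightedError (S ω) (w ω) (A n fun q => (S ω (c 0 q)).2))) else w ω l)
      (F := fun ω x => F ω x + Real.log (1 / ((weightedError (S ω) (w ω)
          (A n fun q => (S ω (c 0 q)).2) /
          (1 - weightedError (S ω) (w ω) (A n fun q => (S ω (c 0 q)).2)) : ℝ≥0) : ℝ)) *
        ((if A n (fun q => (S ω (c 0 q)).2) x = true then 1 else 0) - 1 / 2))
      (measurable_pi_lambda _ fun l =>
        Measurable.ite (hcorrect l) ((hwl l).mul hb) (hwl l))
      (hF.add ((Real.measurable_log.comp (measurable_const.div
        (hb.coe_nnreal_real.comp measurable_fst))).mul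
          ((Measurable.ite (measurableSet_eq_fun hh measurable_const)
            measurable_const measurable_const).sub measurable_const)))
    simp only [boostOut, ite_apply]
    exact Measurable.ite ((he.comp measurable_fst) (measurableSet_singleton 0)) hh hih

end BoostOut

/-! ### Accuracy of the two first steps on the mixture -/

section FirstStep

variable {k : ℕ} {X : Type u} [MeasurableSpace X]

/-- The uniform mixture of the distributions of the players in `N`, tagged with the player. -/
noncomputable def mixture (D : Fin k → Measure X) (N : Finset (Fin k)) : Measure (Fin k × X) :=
  (N.card : ℝ≥0∞)⁻¹ • ∑ i ∈ N, (D i).map (Prod.mk i)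

theorem lintegral_mixture (D : Fin k → Measure X) (N : Finset (Fin k)) {f : Fin k × X → ℝ≥0∞}
    (hf : Measurable f) :
    ∫⁻ z, f z ∂(mixture D N) = (N.card : ℝ≥0∞)⁻¹ * ∑ i ∈ N, ∫⁻ x, f (i, x) ∂(D i) := by
  rw [mixture, lintegral_smul_measure, lintegral_finsetSum_measure, smul_eq_mul]
  congr 1
  exact Finset.sum_congr rfl fun i _ => lintegral_map hf measurable_prodMk_left

theorem isProbabilityMeasure_mixture (D : Fin k → Measure X) [∀ i, IsProbabilityMeasure (D i)]
    {N : Finset (Fin k)} (hN : N.Nonempty) : IsProbabilityMeasure (mixture D N) := by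
  refine ⟨?_⟩
  rw [← lintegral_one, lintegral_mixture D N measurable_const]
  simp only [lintegral_const, measure_univ, mul_one, Finset.sum_const, nsmul_eq_mul]
  exact ENNReal.inv_mul_cancel (by simpa using hN.ne_empty) (by simp)

theorem mixture_apply_snd (D : Fin k → Measure X) (N : Finset (Fin k)) {E : Set X}
    (hE : MeasurableSet E) :
    mixture D N {z | z.2 ∈ E} = (N.card : ℝ≥0∞)⁻¹ * ∑ i ∈ N, D i E := by
  have hE' : MeasurableSet {z : Fin k × X | z.2 ∈ E} := measurable_snd hE
  rw [← lintegral_indicator_one hE',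
    lintegral_mixture D N (measurable_one.indicator hE')]
  congr 1
  refine Finset.sum_congr rfl fun i _ => ?_
  rw [← lintegral_indicator_one hE]
  rfl

/-- The labelled example of a player that corresponds to a tagged point. -/
def labelled (hstar : X → Bool) (z : Fin k × X) : Fin k × (X × Bool) := (z.1, (z.2, hstar z.2))

theorem measurable_labelled {hstar : X → Bool} (hm : Measurable hstar) :
    Measurable (labelled (k := k) hstar) :=
  measurable_fst.prodMk (measurable_snd.prodMk (hm.comp measurable_snd))

theorem hasLaw_drawMixture (D : Fin k → Measure X) (hstar : X → Bool) (N : Finset (Fin k)) :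
    Prog.HasLaw D hstar (drawMixture N) (mixture D N) (labelled hstar) := by
  intro f hf
  rw [lintegral_mixture D N hf]
  simp only [drawMixture, Prog.expect, Prog.draw, Prog.bind, labelled]
  have h1 : ∑ i : Fin k, (((if i ∈ N then 1 else 0 : ℝ≥0)) : ℝ≥0∞) = N.card := by
    simp [← ENNReal.ofNNReal_finsetSum]
  rw [h1, Finset.mul_sum, ← Finset.sum_subset (Finset.subset_univ N)]
  · refine Finset.sum_congr rfl fun i hi => ?_
    simp [hi]
  · intro i _ hi
    simp [hi]

/-- Samples on which the candidate classifiers that fit them are accurate. -/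
def goodSamples (D : Fin k → Measure X) (hstar : X → Bool) (N : Finset (Fin k)) {C : Type*}
    {m : ℕ} (g : C → (Fin m → Fin k × (X × Bool)) → X → Bool) (ε : ℝ) :
    Set (Fin m → Fin k × (X × Bool)) :=
  {S | (∀ l, (S l).2.2 = hstar (S l).2.1) ∧ ∀ c, (∀ l, g c S (S l).2.1 = (S l).2.2) →
    mixture D N {z | g c S z.2 ≠ hstar z.2} < ENNReal.ofReal ε}

/-- Labels drawn from the players are always those of the target, so the first condition in
`goodSamples` is automatic; the second is the complement of the double sampling event. -/
theorem le_expect_goodSamples (D : Fin k → Measure X) [∀ i, IsProbabilityMeasure (D i)]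
    {hstar : X → Bool} (hm : Measurable hstar) {N : Finset (Fin k)} (hN : N.Nonempty)
    {C : Type*} [Finite C] {m : ℕ} (𝓖 : Set (X → Bool))
    (g : C → (Fin m → Fin k × (X × Bool)) → X → Bool)
    (hg : ∀ c S, (∀ l, (S l).2.2 = hstar (S l).2.1) → g c S ∈ 𝓖)
    (hgm : ∀ c, Measurable fun p : (Fin m → Fin k × (X × Bool)) × X => g c p.1 p.2) (G : ℕ)
    (hG : ∀ u : Fin m × Bool → X, (traces 𝓖 u).card ≤ G) {ε : ℝ} (hε : 8 ≤ m * ε) :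
    1 - ENNReal.ofReal (2 * G * Real.exp (-(m * ε / 8))) ≤
      (Prog.each m fun _ => drawMixture N).expect D hstar
        ((goodSamples D hstar N g ε).indicator 1) := by
  have := isProbabilityMeasure_mixture D hN
  have hlab : Measurable fun s : Fin m → Fin k × X => fun l => labelled hstar (s l) :=
    measurable_pi_lambda _ fun l => (measurable_labelled hm).comp (measurable_pi_apply l)
  have hpred : ∀ c, Measurable fun p : (Fin m → Fin k × X) × (Fin k × X) =>
      g c (fun l => labelled hstar (p.1 l)) p.2.2 := fun c =>
    (hgm c).comp ((hlab.comp measurable_fst).prodMk measurable_snd.snd)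
  have hE : ∀ c, MeasurableSet {p : (Fin m → Fin k × X) × (Fin k × X) |
      g c (fun l => labelled hstar (p.1 l)) p.2.2 ≠ hstar p.2.2} := fun c =>
    (measurableSet_eq_fun (hpred c) (hm.comp measurable_snd.snd)).compl
  have h := measure_exists_consistent_inaccurate_le (mixture D N) m Prod.snd 𝓖
    (fun c s => g c fun l => labelled hstar (s l)) (fun c s => hg c _ fun l => rfl) hstar hE G hG hε
  let U : Set (Fin m → Fin k × X) := {s | ∃ c, (∀ i, g c (fun l => labelled hstar (s l)) (s i).2 =
      hstar (s i).2) ∧ ENNReal.ofReal ε ≤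
        mixture D N {z | g c (fun l => labelled hstar (s l)) z.2 ≠ hstar z.2}}
  -- Passing to the complement requires a measurable event. This is where joint measurability of the
  -- classifiers and finiteness of the index type enter.
  have hU : MeasurableSet U := by
    have : U = ⋃ c, (⋂ i, {s | g c (fun l => labelled hstar (s l)) (s i).2 = hstar (s i).2}) ∩
        {s | ENNReal.ofReal ε ≤
          mixture D N {z | g c (fun l => labelled hstar (s l)) z.2 ≠ hstar z.2}} := by
      ext s; simp [U]
    rw [this]
    refine MeasurableSet.iUnion fun c => (MeasurableSet.iInter fun i => ?_).inter ?_
    · exact measurableSet_eq_fun ((hpred c).comp (measurable_id.prodMk (measurable_pi_apply i)))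
        (hm.comp (measurable_pi_apply i).snd)
    · exact measurableSet_le measurable_const (measurable_measure_prodMk_left (hE c))
  have hind : ∀ s : Fin m → Fin k × X, (goodSamples D hstar N g ε).indicator (1 : (Fin m → Fin k × (X × Bool)) → ℝ≥0∞)
      (fun l => labelled hstar (s l)) = Uᶜ.indicator 1 s := by
    intro s
    have hiff : (fun l => labelled hstar (s l)) ∈ goodSamples D hstar N g ε ↔ s ∈ Uᶜ := by
      simp only [goodSamples, U, Set.mem_ofPred_eq, Set.mem_compl_iff, labelled, implies_true,
        true_and, not_exists, not_and, not_le]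
    by_cases hs : s ∈ Uᶜ
    · rw [Set.indicator_of_mem hs, Set.indicator_of_mem (hiff.2 hs)]; rfl
    · rw [Set.indicator_of_notMem hs, Set.indicator_of_notMem (hiff.not.2 hs)]
  rw [(hasLaw_drawMixture D hstar N).each m _ (by
    simp only [hind]; exact measurable_one.indicator hU.compl)]
  simp only [hind]
  rw [lintegral_indicator_one hU.compl, prob_compl_eq_one_sub hU]
  exact tsub_le_tsub_left h _

/-- Measurable classifiers with small error on the mixture of the players in `N`. -/
def accurate (D : Fin k → Measure X) (hstar : X → Bool) (N : Finset (Fin k)) (ε : ℝ) :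
    Set (X → Bool) :=
  {h | Measurable h ∧ mixture D N {z | h z.2 ≠ hstar z.2} < ENNReal.ofReal ε}

theorem le_expect_consistentStep {H : Set (X → Bool)} {d : ℕ} (hH : vcDim H ≤ d)
    {A : Learner X} (hA : A.IsConsistent H) (hAm : A.IsMeasurable) {hstar : X → Bool}
    (hs : hstar ∈ H) (hm : Measurable hstar) (D : Fin k → Measure X)
    [∀ i, IsProbabilityMeasure (D i)] {N : Finset (Fin k)} (hN : N.Nonempty) {m : ℕ} {ε : ℝ}
    (hε : 8 ≤ m * ε) :
    1 - ENNReal.ofReal (2 * ((2 * m + 1) ^ d : ℕ) * Real.exp (-(m * ε / 8))) ≤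
      (consistentStep A m N).expect D hstar ((accurate D hstar N ε).indicator 1) := by
  have hcons := fun (S : Fin m → Fin k × (X × Bool)) (hS : ∀ l, (S l).2.2 = hstar (S l).2.1) =>
    hA m (fun l => (S l).2) ⟨hstar, hs, fun l => (hS l).symm⟩
  have hAm' : Measurable fun p : (Fin m → Fin k × (X × Bool)) × X =>
      A m (fun l => (p.1 l).2) p.2 :=
    (hAm m).comp ((measurable_pi_lambda _ fun l =>
      ((measurable_pi_apply l).comp measurable_fst).snd).prodMk measurable_snd)
  have h := le_expect_goodSamples D hm hN H (C := Unit) (m := m) (fun _ S => A m fun l => (S l).2)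
    (fun _ S hS => (hcons S hS).1) (fun _ => hAm') _
    (fun u => (card_traces_le hH u).trans (sum_choose_le_pow _ _)) hε
  have hc : Fintype.card (Fin m × Bool) = 2 * m := by simp; ring
  rw [hc] at h
  rw [← mul_one (1 - _)]
  refine Prog.mul_le_expect_bind h fun S hS => ?_
  have hmem : (A m fun l => (S l).2) ∈ accurate D hstar N ε :=
    ⟨hAm'.comp measurable_prodMk_left, hS.2 () (hcons S hS.1).2⟩
  simp [Prog.expect, hmem]

/-- The candidates are indexed by all tuples of resampled indices. On a good sample every candidate
that fits the reservoirs is accurate, whichever indices are drawn, so boosting only has to fit. In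
the exponent, dT comes from the T voters and T from their coefficients. -/
theorem le_expect_distributedBoosting {H : Set (X → Bool)} {d : ℕ} (hd : 0 < d)
    (hH : vcDim H ≤ d) {A : Learner X} (hA : A.IsConsistent H) (hAm : A.IsMeasurable)
    {hstar : X → Bool} (hs : hstar ∈ H) (hm : Measurable hstar) (D : Fin k → Measure X)
    [∀ i, IsProbabilityMeasure (D i)] {N : Finset (Fin k)} (hN : N.Nonempty) {m T : ℕ} {ε : ℝ}
    (hε : 8 ≤ m * ε) :
    (1 - ENNReal.ofReal (2 * ((2 * m + 1) ^ (d * T + T) : ℕ) * Real.exp (-(m * ε / 8)))) *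
      (1 - ENNReal.ofReal ((9 / 10) ^ T * m)) ≤
      (distributedBoosting A m (512 * d) T N).expect D hstar
        ((accurate D hstar N ε).indicator 1) := by
  have hm0 : 0 < m := Nat.pos_of_ne_zero fun h => by simp [h] at hε; linarith
  have hmeas : ∀ c : Fin T → Fin (512 * d) → Fin m, Measurable
      fun p : (Fin m → Fin k × (X × Bool)) × X =>
        boostOut A (512 * d) p.1 T c (fun _ => 1) (fun _ => 0) p.2 := fun c =>
    measurable_boostOut hAm (512 * d) (S := fun S => S) (w := fun _ _ => 1) (F := fun _ _ => 0)
      measurable_id T c measurable_const measurable_const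
  have h := le_expect_goodSamples D hm hN (majorityClass H T) (m := m)
    (fun (c : Fin T → Fin (512 * d) → Fin m) S =>
      boostOut A (512 * d) S T c (fun _ => 1) fun _ => 0)
    (fun c S hS => boostOut_mem_majorityClass hA hs (512 * d) hS T c _) hmeas
    ((2 * m + 1) ^ (d * T + T)) (fun u => ?_) hε
  · refine Prog.mul_le_expect_bind h fun S hS => ?_
    refine le_trans ?_ ((le_expect_boostRounds hd hH hA hs D hm0 hS.1 T (fun _ => 1) (fun _ => 0)
      one_pos fun l => by simp [expLoss]).trans
        (expect_boostRounds_le_of_boostOut D hstar A (512 * d) S T _ _ fun c => ?_))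
    · simp [expLoss]
    · by_cases hc : ∀ l, boostOut A (512 * d) S T c (fun _ => 1) (fun _ => 0) (S l).2.1 = (S l).2.2
      · have hmem : boostOut A (512 * d) S T c (fun _ => 1) (fun _ => 0) ∈
            accurate D hstar N ε :=
          ⟨(hmeas c).comp measurable_prodMk_left, hS.2 c hc⟩
        rw [Set.indicator_of_mem hmem, Set.indicator_of_mem (by exact hc)]
      · rw [Set.indicator_of_notMem (by exact hc)]
        exact zero_le
  · have hc : Fintype.card (Fin m × Bool) = 2 * m := by simp; ring
    have h1 := (card_traces_le hH u).trans (sum_choose_le_pow _ _)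
    have h2 := sum_choose_le_pow (2 * m) T
    refine (card_traces_majorityClass_le H T u).trans ?_
    rw [hc] at h1 ⊢
    rw [pow_add, pow_mul]
    gcongr

end FirstStep

/-! ### Correctness of the tests -/

section Test

theorem empiricalError_eq_hits_div {X : Type*} {t : ℕ} (h hstar : X → Bool) (s : Fin t → X) :
    empiricalError h (fun q => (s q, hstar (s q))) = hits {x | h x ≠ hstar x} s / t := by
  simp only [empiricalError, hits, Set.mem_ofPred_eq]
  congr 1
  refine Finset.sum_congr rfl fun i _ => ?_
  by_cases hi : h (s i) = hstar (s i) <;> simp [hi]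

variable {k : ℕ} {X : Type u} [MeasurableSpace X]

/-- The test of one player accepts classifiers of error at most `ε / 2` and rejects classifiers
of error at least `ε`, except with small probability. -/
theorem le_expect_test_player (D : Fin k → Measure X) [∀ i, IsProbabilityMeasure (D i)]
    {hstar h : X → Bool} (hm : Measurable hstar) (hh : Measurable h) (i : Fin k) {t : ℕ}
    (ht : 0 < t) {ε : ℝ} (hε : 0 < ε) :
    ENNReal.ofReal (1 - Real.exp (-(t * ε / 60))) ≤
      (Prog.bind (Prog.each t fun _ => Prog.draw i) fun z =>
        Prog.ret (decide (empiricalError h z ≤ 3 * ε / 4))).expect D hstar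
        ({b : Bool | ((D i).real {x | h x ≠ hstar x} ≤ ε / 2 → b = true) ∧
          (b = true → (D i).real {x | h x ≠ hstar x} < ε)}.indicator 1) := by
  set E := {x | h x ≠ hstar x} with hE
  have hEm : MeasurableSet E := (measurableSet_eq_fun hh hm).compl
  set Q : Set Bool := {b : Bool | ((D i).real E ≤ ε / 2 → b = true) ∧
    (b = true → (D i).real E < ε)} with hQ
  have ht' : (0 : ℝ) < t := by exact_mod_cast ht
  have hdec : ∀ s : Fin t → X, empiricalError h (fun q => (s q, hstar (s q))) ≤ 3 * ε / 4 ↔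
      hits E s ≤ t * (3 * ε / 4) := fun s => by
    rw [empiricalError_eq_hits_div, div_le_iff₀ ht', mul_comm]
  let V : Set (Fin t → X) := {s | decide (hits E s ≤ t * (3 * ε / 4)) ∈ Q}
  have hhm : Measurable fun s : Fin t → X => hits E s :=
    measurable_hits (E := fun _ => E) (measurable_snd hEm) measurable_id
  have hV : MeasurableSet V := by
    have hb : Measurable fun s : Fin t → X => decide (hits E s ≤ t * (3 * ε / 4)) :=
      measurable_to_bool (by
        have : MeasurableSet {s : Fin t → X | hits E s ≤ t * (3 * ε / 4)} :=
          measurableSet_le hhm measurable_const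
        convert this using 1
        ext p
        simp)
    exact hb MeasurableSet.of_discrete
  have hbad : (Measure.pi fun _ : Fin t => D i) Vᶜ ≤ ENNReal.ofReal (Real.exp (-(t * ε / 60))) := by
    rcases le_or_gt ((D i).real E) (ε / 2) with h1 | h1
    -- Upper tail with base 2: the exponent is at most tε(1/2 - (3/4) log 2) < -tε/60.
    · refine (measure_mono fun s hs => ?_).trans ((measure_le_hits_le_of_le (D i) t hEm h1
        (a := 2) (by norm_num) (t * (3 * ε / 4))).trans (ENNReal.ofReal_le_ofReal
        (Real.exp_le_exp.2 ?_)))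
      · by_contra hlt
        refine hs ?_
        have hle := (not_le.1 (Set.mem_ofPred.not.1 hlt)).le
        exact ⟨fun _ => by simpa using hle, fun _ => by linarith⟩
      · have := Real.log_two_gt_d9
        have h2 : 0 < t * ε := by positivity
        nlinarith
    rcases lt_or_ge ((D i).real E) ε with h2 | h2
    -- For an error strictly between ε/2 and ε both verdicts are correct.
    · have : Vᶜ = ∅ := by
        rw [Set.compl_empty_iff, Set.eq_univ_iff_forall]
        exact fun s => ⟨fun h3 => absurd h3 (not_le.2 h1), fun _ => h2⟩
      rw [this]
      simp
    -- Lower tail with base 3/4: since log(3/4) ≥ -3/10, the exponent is at most tε(-1/4 + 9/40) =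
    -- -tε/40.
    · refine (measure_mono fun s hs => ?_).trans ((measure_hits_le_of_le (D i) t hEm h2
        (a := 3 / 4) (by norm_num) (by norm_num) (t * (3 * ε / 4))).trans
        (ENNReal.ofReal_le_ofReal (Real.exp_le_exp.2 ?_)))
      · by_contra hlt
        refine hs ?_
        have hlt' : ¬ hits E s ≤ t * (3 * ε / 4) := hlt
        exact ⟨fun h3 => by linarith, fun h3 => absurd (by simpa using h3) hlt'⟩
      · have h3 : -(3 / 10) ≤ Real.log (3 / 4) := by
          rw [Real.le_log_iff_exp_le (by norm_num), Real.exp_neg, inv_le_comm₀ (Real.exp_pos _)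
            (by norm_num)]
          have := Real.quadratic_le_exp_of_nonneg (show (0 : ℝ) ≤ 3 / 10 by norm_num)
          norm_num at this ⊢
          linarith
        have h4 : 0 < t * ε := by positivity
        nlinarith
  have hind : ∀ s : Fin t → X, (Q.indicator (1 : Bool → ℝ≥0∞)
      (decide (empiricalError h (fun q => (s q, hstar (s q))) ≤ 3 * ε / 4))) =
      V.indicator 1 s := by
    intro s
    simp only [hdec]
    by_cases hs : s ∈ V
    · rw [Set.indicator_of_mem hs, Set.indicator_of_mem (by exact hs)]; rfl
    · rw [Set.indicator_of_notMem hs, Set.indicator_of_notMem (by exact hs)]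
  rw [Prog.expect_bind, (Prog.hasLaw_draw i D hstar).each t _ (by
    simp only [Prog.expect, hind]; exact measurable_one.indicator hV)]
  simp only [Prog.expect, hind]
  rw [lintegral_indicator_one hV, ENNReal.ofReal_sub _ (Real.exp_pos _).le, ENNReal.ofReal_one,
    ← compl_compl V, prob_compl_eq_one_sub hV.compl]
  exact tsub_le_tsub_left hbad _

theorem ofReal_one_sub_mul_le_pow {x : ℝ} (hx1 : x ≤ 1) (n : ℕ) :
    ENNReal.ofReal (1 - n * x) ≤ ENNReal.ofReal (1 - x) ^ n := by
  rw [← ENNReal.ofReal_pow (by linarith)]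
  refine ENNReal.ofReal_le_ofReal ?_
  have := one_add_mul_le_pow (show (-2 : ℝ) ≤ -x by linarith) n
  rw [← sub_eq_add_neg] at this
  linarith

/-- Outcomes of the test in which every player decides correctly. -/
def correctTests (D : Fin k → Measure X) (hstar : X → Bool) (N : Finset (Fin k)) (h : X → Bool)
    (ε : ℝ) : Set (Finset (Fin k)) :=
  {G | G ⊆ N ∧ ∀ i ∈ N, ((D i).real {x | h x ≠ hstar x} ≤ ε / 2 → i ∈ G) ∧
    (i ∈ G → (D i).real {x | h x ≠ hstar x} < ε)}

theorem le_expect_testStep (D : Fin k → Measure X) [∀ i, IsProbabilityMeasure (D i)]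
    {hstar h : X → Bool} (hm : Measurable hstar) (hh : Measurable h) (K δ' : ℝ)
    (N : Finset (Fin k)) {ε : ℝ} (ht : 0 < testSize K ε δ' N) (hε : 0 < ε) :
    ENNReal.ofReal (1 - N.card * Real.exp (-(testSize K ε δ' N * ε / 60))) ≤
      (testStep K ε δ' N h).expect D hstar ((correctTests D hstar N h ε).indicator 1) := by
  set η := Real.exp (-(testSize K ε δ' N * ε / 60)) with hη
  have hη1 : η ≤ 1 := Real.exp_le_one_iff.2 (by
    have : 0 ≤ (testSize K ε δ' N : ℝ) * ε := by positivity
    linarith)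
  refine (ofReal_one_sub_mul_le_pow hη1 _).trans ?_
  have hprod : (ENNReal.ofReal (1 - η)) ^ N.card =
      ∏ i : Fin k, if i ∈ N then ENNReal.ofReal (1 - η) else 1 := by
    rw [Finset.prod_ite]; simp
  rw [hprod, ← mul_one (∏ i : Fin k, _)]
  refine Prog.mul_le_expect_bind (Prog.prod_le_expect_each k _ (fun i => {b : Bool | i ∈ N →
    ((D i).real {x | h x ≠ hstar x} ≤ ε / 2 → b = true) ∧
    (b = true → (D i).real {x | h x ≠ hstar x} < ε)}) _ fun i => ?_) fun pass hpass => ?_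
  · split_ifs with hi
    · simpa only [hi, true_imp_iff] using le_expect_test_player D hm hh i ht hε
    · simp [Prog.expect, hi]
  · have hmem : (N.filter fun i => pass i = true) ∈ correctTests D hstar N h ε := by
      refine ⟨Finset.filter_subset _ _, fun i hi => ?_⟩
      simpa [hi] using hpass i hi
    simp [Prog.expect, hmem]

end Test

/-! ### Halving of the active players and the confidence budget -/

section Loop

variable {k : ℕ} {X : Type u} [MeasurableSpace X]

/-- Markov's inequality: remaining players have error above ε/2, while the average over N is below
ε/4. The strict inequality is what empties the active set within ⌈log₂ k⌉ rounds. -/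
theorem two_mul_card_sdiff_lt (D : Fin k → Measure X) [∀ i, IsProbabilityMeasure (D i)]
    {hstar h : X → Bool} (hm : Measurable hstar) {N G : Finset (Fin k)} (hN : N.Nonempty) {ε : ℝ}
    (hε : 0 < ε) (hacc : h ∈ accurate D hstar N (ε / 4)) (hG : G ∈ correctTests D hstar N h ε) :
    2 * (N \ G).card < N.card := by
  obtain ⟨hh, hlt⟩ := hacc
  set E := {x | h x ≠ hstar x} with hE
  have hEm : MeasurableSet E := (measurableSet_eq_fun hh hm).compl
  have h1 : mixture D N {z | z.2 ∈ E} < ENNReal.ofReal (ε / 4) := hlt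
  have hNpos : (0 : ℝ) < N.card := by exact_mod_cast hN.card_pos
  rw [mixture_apply_snd D N hEm, ENNReal.lt_ofReal_iff_toReal_lt (ENNReal.mul_ne_top
    (by simpa using hN.ne_empty) (ENNReal.sum_ne_top.2 fun i _ => measure_ne_top _ _)),
    ENNReal.toReal_mul, ENNReal.toReal_inv, ENNReal.toReal_natCast,
    ENNReal.toReal_sum fun i _ => measure_ne_top _ _, inv_mul_lt_iff₀ hNpos] at h1
  have h2 : ((N \ G).card : ℝ) * (ε / 2) ≤ ∑ i ∈ N, (D i).real E := by
    calc ((N \ G).card : ℝ) * (ε / 2) = ∑ _i ∈ N \ G, ε / 2 := by simp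
      _ ≤ ∑ i ∈ N \ G, (D i).real E := by
          refine Finset.sum_le_sum fun i hi => ?_
          obtain ⟨hiN, hiG⟩ := Finset.mem_sdiff.1 hi
          by_contra! hlt
          exact hiG ((hG.2 i hiN).1 hlt.le)
      _ ≤ ∑ i ∈ N, (D i).real E :=
          Finset.sum_le_sum_of_subset_of_nonneg Finset.sdiff_subset fun _ _ _ => measureReal_nonneg
  have h3 : (2 * (N \ G).card : ℝ) < N.card := by
    have : ((N \ G).card : ℝ) * (ε / 2) < N.card * (ε / 4) := h2.trans_lt h1
    nlinarith
  exact_mod_cast h3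

theorem le_expect_personalizedLoop (D : Fin k → Measure X) [∀ i, IsProbabilityMeasure (D i)]
    {hstar : X → Bool} (hm : Measurable hstar) {K ε δ' : ℝ} (hε : 0 < ε)
    {learn : Finset (Fin k) → Prog k X (X → Bool)} {a b : ℝ≥0∞} (ha : a ≤ 1) (hb : b ≤ 1)
    (hlearn : ∀ N : Finset (Fin k), N.Nonempty →
      a ≤ (learn N).expect D hstar ((accurate D hstar N (ε / 4)).indicator 1))
    (htest : ∀ (N : Finset (Fin k)) (h : X → Bool), N.Nonempty → Measurable h →
      b ≤ (testStep K ε δ' N h).expect D hstar ((correctTests D hstar N h ε).indicator 1))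
    (r : ℕ) (N : Finset (Fin k)) (f : Fin k → Option (X → Bool)) (hN : N.card ≤ 2 ^ r)
    (hN0 : r = 0 → N = ∅)
    (hf : ∀ i ∉ N, ∃ g : X → Bool, f i = some g ∧ D i {x | g x ≠ hstar x} < ENNReal.ofReal ε) :
    (a * b) ^ r ≤ (personalizedLoop learn K ε δ' r N f).expect D hstar
      ({f | AllAccurate D hstar ε f}.indicator 1) := by
  induction r generalizing N f with
  | zero =>
    have : AllAccurate D hstar ε f := fun i => hf i (by simp [hN0 rfl])
    simp [personalizedLoop, Prog.expect, this]
  | succ r ih =>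
    rw [personalizedLoop]
    split_ifs with h0
    · have : AllAccurate D hstar ε f := fun i => hf i (by simp [h0])
      simpa [Prog.expect, this] using pow_le_one' (mul_le_one' ha hb) (r + 1)
    · have hne := Finset.nonempty_iff_ne_empty.2 h0
      rw [pow_succ', mul_assoc]
      refine Prog.mul_le_expect_bind (hlearn N hne) fun h hh =>
        Prog.mul_le_expect_bind (htest N h hne hh.1) fun G hG => ih _ _ ?_ ?_ ?_
      · have := two_mul_card_sdiff_lt D hm hne hε hh hG
        rw [pow_succ] at hN
        omega
      -- The bound |N| ≤ 2^r alone would allow one player to be left at r = 0. In the last round |N|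
      -- ≤ 2, so strict halving leaves nobody.
      · rintro rfl
        have := two_mul_card_sdiff_lt D hm hne hε hh hG
        have : (N \ G).card = 0 := by
          norm_num at hN
          omega
        exact Finset.card_eq_zero.1 this
      · intro i hi
        by_cases hiG : i ∈ G
        · exact ⟨h, by simp [hiG], (ENNReal.lt_ofReal_iff_toReal_lt (measure_ne_top _ _)).2
            ((hG.2 i (hG.1 hiG)).2 hiG)⟩
        · simpa [hiG] using hf i fun hiN => hi (Finset.mem_sdiff.2 ⟨hiN, hiG⟩)

theorem isPersonalizedPAC_personalizedWith {H : Set (X → Bool)} (hk : 2 ≤ k) {K ε δ : ℝ}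
    (hK : 512 ≤ K) (hε : 0 < ε) (hε1 : ε < 1) (hδ : 0 < δ) (hδ1 : δ < 1)
    {learn : Finset (Fin k) → Prog k X (X → Bool)}
    (hlearn : ∀ hstar ∈ H, Measurable hstar → ∀ D : Fin k → Measure X,
      (∀ i, IsProbabilityMeasure (D i)) → ∀ N : Finset (Fin k), N.Nonempty →
      ENNReal.ofReal (1 - δ / (2 * Real.logb 2 k) / 2) ≤
        (learn N).expect D hstar ((accurate D hstar N (ε / 4)).indicator 1)) :
    IsPersonalizedPAC H ε δ (personalizedWith learn K ε δ) := by
  intro hstar hs hm D hD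
  have hk' : (2 : ℝ) ≤ k := by exact_mod_cast hk
  have hlog : 1 ≤ Real.logb 2 k := by
    rw [Real.le_logb_iff_rpow_le (by norm_num) (by linarith)]; simpa using hk'
  set δ' := δ / (2 * Real.logb 2 k) with hδ'
  have hδ'0 : 0 < δ' := by positivity
  have hδ'1 : δ' ≤ 1 / 2 := by
    rw [hδ', div_le_iff₀ (by linarith)]
    linarith
  have htest : ∀ (N : Finset (Fin k)) (h : X → Bool), N.Nonempty → Measurable h →
      ENNReal.ofReal (1 - δ' / 2) ≤
      (testStep K ε δ' N h).expect D hstar ((correctTests D hstar N h ε).indicator 1) := by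
    intro N h hN hh
    have hN1 : (1 : ℝ) ≤ N.card := by exact_mod_cast hN.card_pos
    set y := (N.card : ℝ) / (ε * δ') with hy
    have hεδ : ε * δ' < 1 := by nlinarith
    have hy1 : 1 < y := by
      rw [hy, one_lt_div (by positivity)]
      linarith
    have hly : 0 < Real.log y := Real.log_pos hy1
    have hpos : 0 < K * (Real.log y / ε) := by positivity
    have hsize : K * (Real.log y / ε) ≤ testSize K ε δ' N := Nat.le_ceil _
    have ht0 : 0 < testSize K ε δ' N := by
      have := hpos.trans_le hsize
      exact_mod_cast this
    refine le_trans (ENNReal.ofReal_le_ofReal ?_) (le_expect_testStep D hm hh K δ' N ht0 hε)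
    -- Since 512/60 > 2, each test fails with probability at most y⁻², and |N| y⁻² = (εδ')²/|N| ≤
    -- δ'² ≤ δ'/2.
    have h1 : 2 * Real.log y ≤ testSize K ε δ' N * ε / 60 := by
      have h2 := mul_le_mul_of_nonneg_right hsize hε.le
      rw [mul_assoc, div_mul_cancel₀ _ hε.ne'] at h2
      nlinarith
    have h2 : Real.exp (-(testSize K ε δ' N * ε / 60)) ≤ (ε * δ' / N.card) ^ 2 := by
      calc Real.exp (-(testSize K ε δ' N * ε / 60)) ≤ Real.exp ((2 : ℕ) * -Real.log y) := by
            refine Real.exp_le_exp.2 ?_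
            push_cast
            linarith
        _ = (ε * δ' / N.card) ^ 2 := by
            rw [Real.exp_nat_mul, Real.exp_neg, Real.exp_log (by linarith), hy, inv_div]
    have h3 : N.card * Real.exp (-(testSize K ε δ' N * ε / 60)) ≤ δ' / 2 := by
      calc N.card * Real.exp (-(testSize K ε δ' N * ε / 60))
          ≤ N.card * (ε * δ' / N.card) ^ 2 := by gcongr
        _ = (ε * δ') ^ 2 / N.card := by field_simp
        _ ≤ (ε * δ') ^ 2 := div_le_self (by positivity) hN1
        _ ≤ (1 * δ') ^ 2 := by gcongr
        _ ≤ δ' / 2 := by nlinarith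
    linarith
  have h1 : ENNReal.ofReal (1 - δ' / 2) ≤ 1 := by
    rw [ENNReal.ofReal_le_one]; linarith
  have hloop := le_expect_personalizedLoop D hm (K := K) (δ' := δ') hε h1 h1
    (hlearn hstar hs hm D hD) htest (Nat.clog 2 k) Finset.univ (fun _ => none)
    (by simpa using Nat.le_pow_clog (by norm_num) k)
    (fun h => absurd h (Nat.clog_pos (by norm_num) hk).ne') (by simp)
  rw [Prog.prob_eq_expect]
  refine le_trans ?_ (hloop.trans (le_of_eq ?_))
  · rw [← pow_two, ← pow_mul]
    refine le_trans (ENNReal.ofReal_le_ofReal ?_)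
      (ofReal_one_sub_mul_le_pow (by linarith) _)
    -- As k ≥ 2, ⌈log₂ k⌉ < log₂ k + 1 ≤ 2 log₂ k; this is the 2 in δ' = δ/(2 log₂ k).
    have h2 : (Nat.clog 2 k : ℝ) ≤ 2 * Real.logb 2 k := by
      have h3 := Nat.ceil_lt_add_one (show 0 ≤ Real.logb (2 : ℕ) k by push_cast; linarith)
      rw [Real.natCeil_logb_natCast] at h3
      push_cast at h3
      linarith
    have h3 : (Nat.clog 2 k : ℝ) * δ' ≤ δ := by
      calc (Nat.clog 2 k : ℝ) * δ' ≤ 2 * Real.logb 2 k * δ' := by gcongr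
        _ = δ := by rw [hδ']; field_simp
    push_cast
    linarith
  · unfold personalizedWith
    congr 1

end Loop

/-! ### Sample cost of the algorithms -/

section Cost

variable {k : ℕ} {X : Type u}

theorem samples_drawMixture_le (N : Finset (Fin k)) :
    (drawMixture N : Prog k X _).samples ≤ 1 := by
  refine iSup_le fun i => ?_
  simp [Prog.draw, Prog.bind, Prog.samples]

theorem samples_consistentStep_le (A : Learner X) (m : ℕ) (N : Finset (Fin k)) :
    (consistentStep A m N).samples ≤ m :=
  (Prog.samples_bind_le (Prog.samples_each_le m fun _ => samples_drawMixture_le N)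
    (b := 0) fun _ => by simp [Prog.samples]).trans (by simp)

theorem samples_resample_le {m : ℕ} (S : Fin m → Fin k × (X × Bool)) (w : Fin m → ℝ≥0) :
    (resample S w).samples ≤ 0 := by
  simp [resample, Prog.samples]

theorem samples_boostRounds_le (A : Learner X) (n : ℕ) {m : ℕ}
    (S : Fin m → Fin k × (X × Bool)) (T : ℕ) (w : Fin m → ℝ≥0) (F : X → ℝ) :
    (boostRounds A n S T w F).samples ≤ 0 := by
  induction T generalizing w F with
  | zero => simp [boostRounds, Prog.samples]
  | succ T ih =>
    rw [boostRounds]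
    refine (Prog.samples_bind_le (Prog.samples_each_le n fun _ => samples_resample_le S w)
      (b := 0) fun idx => ?_).trans (by simp)
    dsimp only
    split_ifs
    · simp [Prog.samples]
    · exact ih _ _

theorem samples_distributedBoosting_le (A : Learner X) (m n T : ℕ) (N : Finset (Fin k)) :
    (distributedBoosting A m n T N).samples ≤ m :=
  (Prog.samples_bind_le (Prog.samples_each_le m fun _ => samples_drawMixture_le N)
    (b := 0) fun S => samples_boostRounds_le A n S T (fun _ => 1) fun _ => 0).trans (by simp)

theorem samples_testStep_le (K ε δ' : ℝ) (N : Finset (Fin k)) (h : X → Bool) :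
    (testStep K ε δ' N h).samples ≤ k * testSize K ε δ' N := by
  refine (Prog.samples_bind_le (Prog.samples_each_le k (a := testSize K ε δ' N) fun i => ?_)
    (b := 0) fun _ => by simp [Prog.samples]).trans (by simp)
  split_ifs
  · simpa using Prog.samples_bind_le (Prog.samples_each_le (testSize K ε δ' N)
      fun _ => Prog.samples_draw_le i)
      (q := fun z => Prog.ret (decide (empiricalError h z ≤ 3 * ε / 4))) (b := 0)
      fun _ => by simp [Prog.samples]
  · simp [Prog.samples]

theorem samples_personalizedLoop_le {learn : Finset (Fin k) → Prog k X (X → Bool)} {K ε δ' : ℝ}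
    {m t : ℕ} (hlearn : ∀ N, (learn N).samples ≤ m)
    (ht : ∀ N : Finset (Fin k), N.Nonempty → testSize K ε δ' N ≤ t) (r : ℕ)
    (N : Finset (Fin k)) (f : Fin k → Option (X → Bool)) :
    (personalizedLoop learn K ε δ' r N f).samples ≤ (r * (m + k * t) : ℕ) := by
  induction r generalizing N f with
  | zero => simp [personalizedLoop, Prog.samples]
  | succ r ih =>
    rw [personalizedLoop]
    split_ifs with h0
    · simp [Prog.samples]
    · have h1 : ∀ h, (testStep K ε δ' N h : Prog k X _).samples ≤ (k * t : ℕ) := fun h =>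
        (samples_testStep_le K ε δ' N h).trans (by
          have := Nat.mul_le_mul_left k (ht N (Finset.nonempty_iff_ne_empty.2 h0))
          exact_mod_cast this)
      refine (Prog.samples_bind_le (hlearn N) fun h => Prog.samples_bind_le (h1 h)
        fun G => ih _ _).trans (le_of_eq ?_)
      push_cast
      ring

end Cost

/-! ### Choice of the sample sizes and of the number of rounds -/

section Sizes

theorem mul_exp_sub_le_one {R a : ℝ} (ha : 1 ≤ a) (hR : R = 1000 * a) {L : ℝ} (hL : 1 ≤ L) :
    32 * a * (R ^ 2) ^ 2 * Real.exp (4 * L - R ^ 2 * L / 10) ≤ 1 := by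
  have hR0 : 1000 ≤ R := by linarith
  have h1 : 32 * a * (R ^ 2) ^ 2 ≤ Real.exp (5 * R) := by
    have h2 : R ≤ Real.exp R := by linarith [Real.add_one_le_exp R]
    calc 32 * a * (R ^ 2) ^ 2 ≤ R * R ^ 4 := by
          rw [← pow_mul]
          gcongr
          linarith
      _ = R ^ 5 := by ring
      _ ≤ Real.exp R ^ 5 := by gcongr
      _ = Real.exp (5 * R) := by rw [← Real.exp_nat_mul]; norm_num
  calc 32 * a * (R ^ 2) ^ 2 * Real.exp (4 * L - R ^ 2 * L / 10)
      ≤ Real.exp (5 * R) * Real.exp (4 * L - R ^ 2 * L / 10) := by gcongr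
    _ = Real.exp (5 * R + (4 * L - R ^ 2 * L / 10)) := (Real.exp_add _ _).symm
    _ ≤ 1 := by
        rw [Real.exp_le_one_iff]
        have : R * 1 ≤ R * L := by gcongr
        nlinarith

theorem ceil_le_two_mul {x : ℝ} (hx : 1 ≤ x) : (⌈x⌉₊ : ℝ) ≤ 2 * x := by
  have := Nat.ceil_lt_add_one (show 0 ≤ x by linarith)
  linarith

theorem clog_le_three_mul_log {k : ℕ} (hk : 2 ≤ k) : (Nat.clog 2 k : ℝ) ≤ 3 * Real.log k := by
  have hk' : (2 : ℝ) ≤ k := by exact_mod_cast hk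
  have hl : Real.log 2 ≤ Real.log k := Real.log_le_log (by norm_num) hk'
  have h2 := Real.log_two_gt_d9
  have h3 := Nat.ceil_lt_add_one (show 0 ≤ Real.logb (2 : ℕ) k by
    rw [Real.logb]; push_cast; apply div_nonneg <;> linarith)
  rw [Real.natCeil_logb_natCast] at h3
  push_cast at h3
  have h4 : Real.logb 2 k * Real.log 2 = Real.log k := by
    rw [Real.logb, div_mul_cancel₀]; linarith
  have h5 : 1 ≤ Real.logb 2 k := by
    by_contra! h
    nlinarith
  nlinarith

variable {k d : ℕ} {ε δ a : ℝ}

/-- Bounds on the parameters of the learning problem in terms of the logarithmic factor. -/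
theorem parameter_bounds (hk : 2 ≤ k) (hε : 0 < ε) (hε1 : ε < 1) (hδ : 0 < δ) (hδ1 : δ < 1)
    (hd : 1 ≤ d) (hka : (k : ℝ) ≤ a * d) :
    1 ≤ Real.log (2 + d / (ε * δ)) ∧ 1 ≤ (d : ℝ) / ε ∧
      (d : ℝ) / ε ≤ Real.exp (Real.log (2 + d / (ε * δ))) ∧
      0 < δ / (2 * Real.logb 2 k) ∧
      (δ / (2 * Real.logb 2 k))⁻¹ ≤ 4 * a * Real.exp (Real.log (2 + d / (ε * δ))) ∧
      k / (ε * (δ / (2 * Real.logb 2 k))) ≤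
        4 * a ^ 2 * Real.exp (Real.log (2 + d / (ε * δ))) ^ 2 := by
  have hk' : (2 : ℝ) ≤ k := by exact_mod_cast hk
  have hd' : (1 : ℝ) ≤ d := by exact_mod_cast hd
  have hεδ : ε * δ ≤ 1 := by nlinarith
  have hεδ0 : 0 < ε * δ := by positivity
  have hx : 1 ≤ d / (ε * δ) := by rw [le_div_iff₀ hεδ0]; linarith
  have hdε : (d : ℝ) / ε ≤ d / (ε * δ) := by
    apply div_le_div_of_nonneg_left (by positivity) hεδ0; nlinarith
  have hdδ : (d : ℝ) / δ ≤ d / (ε * δ) := by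
    apply div_le_div_of_nonneg_left (by positivity) hεδ0; nlinarith
  have hdx : (d : ℝ) ≤ d / (ε * δ) := le_div_self (by positivity) hεδ0 hεδ
  have hlogb : 1 ≤ Real.logb 2 k := by
    rw [Real.le_logb_iff_rpow_le (by norm_num) (by linarith)]; simpa using hk'
  have hlogb2 : Real.logb 2 k ≤ 2 * k := by
    rw [Real.logb, div_le_iff₀ (Real.log_pos (by norm_num))]
    nlinarith [Real.log_two_gt_d9, Real.log_le_sub_one_of_pos (show (0 : ℝ) < k by linarith)]
  rw [Real.exp_log (by linarith)]
  set x := (d : ℝ) / (ε * δ) with hxdef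
  have ha : 0 < a := pos_of_mul_pos_left (by linarith : 0 < a * (d : ℝ)) (by linarith)
  have hδ' : (δ / (2 * Real.logb 2 k))⁻¹ ≤ 4 * a * (d / δ) := by
    rw [inv_div, ← mul_div_assoc]
    exact div_le_div_of_nonneg_right (by linarith) hδ.le
  refine ⟨?_, ?_, by linarith, by positivity, hδ'.trans ?_, ?_⟩
  · rw [Real.le_log_iff_exp_le (by linarith)]
    linarith [Real.exp_one_lt_d9]
  · rw [le_div_iff₀ hε]; linarith
  · gcongr; linarith
  · calc k / (ε * (δ / (2 * Real.logb 2 k))) = k * (δ / (2 * Real.logb 2 k))⁻¹ / ε := by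
          field_simp
      _ ≤ (a * d) * (4 * a * (d / δ)) / ε := by gcongr
      _ = 4 * a ^ 2 * (d * x) := by rw [hxdef]; field_simp
      _ ≤ 4 * a ^ 2 * ((2 + x) * (2 + x)) := by gcongr <;> linarith
      _ = _ := by ring

/-- The entropy (dT+T) log(2m+1) is at most of order R³ d L², whereas mε/32 is at least R⁴ d L²/32.
As R ≥ 1000, the latter wins and leaves room for the factor 1/δ'. -/
theorem growth_mul_exp_le {R D L N δ' : ℝ} {m T d : ℕ} (ha : 1 ≤ a) (hR : R = 1000 * a)
    (hL : 1 ≤ L) (hd : 1 ≤ d) (hδ' : 0 < δ') (hδ'a : δ'⁻¹ ≤ 4 * a * Real.exp L)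
    (hD : D ≤ Real.exp L) (hD1 : 1 ≤ D) (hN : N = (R ^ 2) ^ 2 * D * L ^ 2) (hmN : (m : ℝ) ≤ 2 * N)
    (hε : 0 < ε) (hDε : D = d / ε) (hNm : N ≤ m) (hT1 : 1 ≤ T) (hT : (T : ℝ) ≤ 2 * (R ^ 2 * L)) :
    2 * ((2 * m + 1) ^ (d * T + T) : ℕ) * Real.exp (-(m * (ε / 4) / 8)) ≤ δ' / 4 := by
  have hR0 : 1000 ≤ R := by linarith
  have hd' : (1 : ℝ) ≤ d := by exact_mod_cast hd
  have hlogm : Real.log (2 * m + 1) ≤ 4 * R + 5 * L := by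
    have h1 : (2 * m + 1 : ℝ) ≤ Real.exp (4 * R + 5 * L) := by
      have h2 : R + 1 ≤ Real.exp R := Real.add_one_le_exp R
      have h3 : L + 1 ≤ Real.exp L := Real.add_one_le_exp L
      have h4 : 1 ≤ N := by
        rw [hN]
        have h5 : (1 : ℝ) ≤ (R ^ 2) ^ 2 := one_le_pow₀ (one_le_pow₀ (by linarith))
        have h6 : (1 : ℝ) ≤ L ^ 2 := one_le_pow₀ hL
        exact one_le_mul_of_one_le_of_one_le (one_le_mul_of_one_le_of_one_le h5 hD1) h6
      have h7 : (5 : ℝ) ≤ Real.exp L ^ 2 := by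
        have := Real.exp_one_gt_d9
        have : Real.exp 1 ≤ Real.exp L := Real.exp_le_exp.2 hL
        nlinarith
      calc (2 * m + 1 : ℝ) ≤ 5 * N := by linarith
        _ = 5 * (R ^ 4 * D * L ^ 2) := by rw [hN]; ring
        _ ≤ Real.exp L ^ 2 * (Real.exp R ^ 4 * Real.exp L * Real.exp L ^ 2) := by
            gcongr <;> linarith
        _ = Real.exp R ^ 4 * Real.exp L ^ 5 := by ring
        _ = Real.exp (4 * R + 5 * L) := by
            rw [← Real.exp_nat_mul, ← Real.exp_nat_mul, ← Real.exp_add]; norm_num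
    rw [Real.log_le_iff_le_exp (by positivity)]
    exact h1
  have hpow : (((2 * m + 1) ^ (d * T + T) : ℕ) : ℝ) ≤
      Real.exp (4 * d * (R ^ 2 * L) * (4 * R + 5 * L)) := by
    push_cast
    rw [← Real.exp_log (show (0 : ℝ) < 2 * m + 1 by positivity), ← Real.exp_nat_mul]
    refine Real.exp_le_exp.2 ?_
    push_cast
    have h1 : (d * T + T : ℝ) ≤ 4 * d * (R ^ 2 * L) := by
      have h2 : (T : ℝ) ≤ d * T := le_mul_of_one_le_left (by positivity) hd'
      have h3 : (d : ℝ) * T ≤ d * (2 * (R ^ 2 * L)) := by gcongr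
      linarith
    have h0 : 0 ≤ Real.log (2 * m + 1) := Real.log_nonneg (by
      have : (0 : ℝ) ≤ m := Nat.cast_nonneg _
      linarith)
    have : (0 : ℝ) ≤ 4 * d * (R ^ 2 * L) := by positivity
    gcongr
  have hm : (R ^ 2) ^ 2 * (d * L ^ 2) / 32 ≤ m * (ε / 4) / 8 := by
    have h1 : N * ε ≤ m * ε := by gcongr
    have h2 : N * ε = (R ^ 2) ^ 2 * (d * L ^ 2) := by rw [hN, hDε]; field_simp
    linarith
  have hinv : 1 / (4 * a * Real.exp L) ≤ δ' := by
    rw [one_div]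
    exact inv_le_of_inv_le₀ hδ' hδ'a
  have hgoal : 8 * Real.exp (4 * d * (R ^ 2 * L) * (4 * R + 5 * L)) *
      Real.exp (-(m * (ε / 4) / 8)) ≤ 1 / (4 * a * Real.exp L) := by
    rw [le_div_iff₀ (by positivity)]
    have h32 : 32 * a ≤ Real.exp R := by linarith [Real.add_one_le_exp R]
    calc 8 * Real.exp (4 * d * (R ^ 2 * L) * (4 * R + 5 * L)) *
          Real.exp (-(m * (ε / 4) / 8)) * (4 * a * Real.exp L)
        = (32 * a) * Real.exp (4 * d * (R ^ 2 * L) * (4 * R + 5 * L)) *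
          Real.exp (-(m * (ε / 4) / 8)) * Real.exp L := by ring
      _ ≤ Real.exp R * Real.exp (4 * d * (R ^ 2 * L) * (4 * R + 5 * L)) *
          Real.exp (-((R ^ 2) ^ 2 * (d * L ^ 2) / 32)) * Real.exp L := by gcongr
      _ = Real.exp (R + 4 * d * (R ^ 2 * L) * (4 * R + 5 * L) +
          -((R ^ 2) ^ 2 * (d * L ^ 2) / 32) + L) := by
          rw [Real.exp_add, Real.exp_add, Real.exp_add]
      _ ≤ 1 := by
          rw [Real.exp_le_one_iff]
          set y := (d : ℝ) * L ^ 2 with hy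
          have hL2 : L ≤ L ^ 2 := by nlinarith
          have hy1 : 1 ≤ y := by nlinarith
          have hLy : L ≤ y := by nlinarith
          have hdL : (d : ℝ) * L ≤ y := by rw [hy]; gcongr
          have e1 : 4 * d * (R ^ 2 * L) * (4 * R + 5 * L) =
              16 * R ^ 3 * (d * L) + 20 * R ^ 2 * y := by rw [hy]; ring
          have e2 : 16 * R ^ 3 * (d * L) ≤ 16 * R ^ 3 * y := by gcongr
          have e3 : R ≤ R * y := le_mul_of_one_le_right (by linarith) hy1
          have e4 : R * y + 16 * R ^ 3 * y + 20 * R ^ 2 * y + y ≤ (R ^ 2) ^ 2 * y / 32 := by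
            have : R + 16 * R ^ 3 + 20 * R ^ 2 + 1 ≤ (R ^ 2) ^ 2 / 32 := by
              have h3 : 1000 * R ^ 3 ≤ (R ^ 2) ^ 2 := by
                rw [show (R ^ 2) ^ 2 = R * R ^ 3 by ring]; gcongr
              have h2 : 1000 * R ^ 2 ≤ R ^ 3 := by
                rw [show R ^ 3 = R * R ^ 2 by ring]; gcongr
              have h1 : 1000 * R ≤ R ^ 2 := by
                rw [show R ^ 2 = R * R by ring]; gcongr
              linarith
            have := mul_le_mul_of_nonneg_right this (show 0 ≤ y by linarith)
            linarith
          linarith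
  have h8 : 8 * (((2 * m + 1) ^ (d * T + T) : ℕ) : ℝ) * Real.exp (-(m * (ε / 4) / 8)) ≤
      8 * Real.exp (4 * d * (R ^ 2 * L) * (4 * R + 5 * L)) * Real.exp (-(m * (ε / 4) / 8)) := by
    gcongr
  linarith

/-- Here (9/10)^T ≤ exp(-R² L/10) beats m/δ', which is at most a power of R times exp(4L). -/
theorem boosting_rounds_bound {R D L δ' : ℝ} {m T : ℕ} (ha : 1 ≤ a) (hR : R = 1000 * a)
    (hL : 1 ≤ L) (hδ' : 0 < δ') (hδ'a : δ'⁻¹ ≤ 4 * a * Real.exp L) (hD : D ≤ Real.exp L)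
    (hm : (m : ℝ) ≤ 2 * ((R ^ 2) ^ 2 * D * L ^ 2)) (hT : R ^ 2 * L ≤ T) :
    (9 / 10 : ℝ) ^ T * m ≤ δ' / 4 := by
  have hinv : 1 / (4 * a * Real.exp L) ≤ δ' := by
    rw [one_div]
    exact inv_le_of_inv_le₀ hδ' hδ'a
  have h1 : (9 / 10 : ℝ) ^ T ≤ Real.exp (-(R ^ 2 * L / 10)) := by
    calc (9 / 10 : ℝ) ^ T ≤ Real.exp (-(1 / 10)) ^ T := by
          gcongr
          linarith [Real.add_one_le_exp (-(1 / 10 : ℝ))]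
      _ = Real.exp (T * -(1 / 10)) := (Real.exp_nat_mul _ _).symm
      _ ≤ _ := Real.exp_le_exp.2 (by linarith)
  have h2 : L ^ 2 ≤ Real.exp L ^ 2 := by
    have := Real.add_one_le_exp L
    gcongr
    linarith
  have h3 : (9 / 10 : ℝ) ^ T * m * 4 ≤ 1 / (4 * a * Real.exp L) := by
    rw [le_div_iff₀ (by positivity)]
    calc (9 / 10 : ℝ) ^ T * m * 4 * (4 * a * Real.exp L)
        ≤ Real.exp (-(R ^ 2 * L / 10)) *
          (2 * ((R ^ 2) ^ 2 * Real.exp L * Real.exp L ^ 2)) * 4 * (4 * a * Real.exp L) := by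
          gcongr
          refine hm.trans ?_
          gcongr
      _ = 32 * a * (R ^ 2) ^ 2 * (Real.exp L ^ 4 * Real.exp (-(R ^ 2 * L / 10))) := by ring
      _ = 32 * a * (R ^ 2) ^ 2 * Real.exp (4 * L - R ^ 2 * L / 10) := by
          rw [← Real.exp_nat_mul, ← Real.exp_add]; norm_num [sub_eq_add_neg]
      _ ≤ 1 := mul_exp_sub_le_one ha hR hL
  linarith

theorem testSize_le {K δ' : ℝ} (hK : 0 ≤ K) (hε : 0 < ε) (hδ' : 0 < δ') {N : Finset (Fin k)}
    (hN : N.Nonempty) : testSize K ε δ' N ≤ ⌈K * (Real.log (k / (ε * δ')) / ε)⌉₊ := by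
  have hN1 : (0 : ℝ) < N.card := by exact_mod_cast hN.card_pos
  have hNk : (N.card : ℝ) ≤ k := by
    exact_mod_cast (Finset.card_le_univ N).trans_eq (Fintype.card_fin k)
  have h1 : Real.log (N.card / (ε * δ')) ≤ Real.log (k / (ε * δ')) :=
    Real.log_le_log (by positivity) (div_le_div_of_nonneg_right hNk (by positivity))
  exact Nat.ceil_mono (mul_le_mul_of_nonneg_left (div_le_div_of_nonneg_right h1 hε.le) hK)

/-- This is where k = O(d) absorbs the tests of all players into the learning cost. -/
theorem mul_ceil_log_le {L x : ℝ} (ha : 1 ≤ a) (hL : 1 ≤ L) (hε : 0 < ε) (hε1 : ε < 1)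
    (hx0 : 0 < x) (hx : x ≤ 4 * a ^ 2 * Real.exp L ^ 2) (hka : (k : ℝ) ≤ a * d) :
    (k : ℝ) * ⌈512 * (Real.log x / ε)⌉₊ ≤ a * (513 * (4 * a + 6)) * (d / ε) * L ^ 2 := by
  have hlog : Real.log x ≤ (4 * a + 4) * L := by
    rw [Real.log_le_iff_le_exp hx0]
    refine hx.trans ?_
    have h1 : 2 * a ≤ Real.exp (2 * a) := by linarith [Real.add_one_le_exp (2 * a)]
    calc 4 * a ^ 2 * Real.exp L ^ 2 = (2 * a) ^ 2 * Real.exp L ^ 2 := by ring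
      _ ≤ Real.exp (2 * a) ^ 2 * Real.exp L ^ 2 := by gcongr
      _ = Real.exp (4 * a + 2 * L) := by
          rw [← Real.exp_nat_mul, ← Real.exp_nat_mul, ← Real.exp_add]; congr 1; push_cast; ring
      _ ≤ Real.exp ((4 * a + 4) * L) := Real.exp_le_exp.2 (by nlinarith)
  have ht : (⌈512 * (Real.log x / ε)⌉₊ : ℝ) ≤ 513 * (4 * a + 6) * L / ε := by
    have h1 : 512 * (Real.log x / ε) ≤ 512 * (4 * a + 6) * L / ε := by
      rw [mul_div_assoc', mul_assoc]
      gcongr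
      nlinarith
    have h2 : 1 ≤ (4 * a + 6) * L / ε := by
      rw [le_div_iff₀ hε]; nlinarith
    refine (Nat.cast_le.2 (Nat.ceil_mono h1)).trans ?_
    refine (Nat.ceil_lt_add_one (by positivity)).le.trans ?_
    have h3 : 513 * (4 * a + 6) * L / ε =
      512 * (4 * a + 6) * L / ε + (4 * a + 6) * L / ε := by ring
    linarith
  calc (k : ℝ) * ⌈512 * (Real.log x / ε)⌉₊
      ≤ (a * d) * (513 * (4 * a + 6) * L / ε) := by gcongr
    _ = a * (513 * (4 * a + 6)) * (d / ε) * L := by ring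
    _ ≤ a * (513 * (4 * a + 6)) * (d / ε) * L ^ 2 := by
        gcongr
        exact le_self_pow₀ hL two_ne_zero

/-- Suitable sample sizes and numbers of rounds. -/
theorem exists_sizes (c : ℝ) :
    ∃ C : ℝ, 0 < C ∧ ∀ (k d : ℕ) (ε δ : ℝ), 2 ≤ k → 0 < ε → ε < 1 → 0 < δ → δ < 1 →
      (k : ℝ) * Real.log k ≤ c * d → 0 < d ∧ ∃ m T t : ℕ,
        (T : ℝ) ≤ C * Real.log (2 + d / (ε * δ)) ∧ 8 ≤ m * (ε / 4) ∧
        2 * ((2 * m + 1) ^ (d * T + T) : ℕ) * Real.exp (-(m * (ε / 4) / 8)) ≤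
          δ / (2 * Real.logb 2 k) / 4 ∧
        2 * ((2 * m + 1) ^ d : ℕ) * Real.exp (-(m * (ε / 4) / 8)) ≤
          δ / (2 * Real.logb 2 k) / 4 ∧
        (9 / 10 : ℝ) ^ T * m ≤ δ / (2 * Real.logb 2 k) / 4 ∧
        (∀ N : Finset (Fin k), N.Nonempty → testSize 512 ε (δ / (2 * Real.logb 2 k)) N ≤ t) ∧
        (Nat.clog 2 k * (m + k * t) : ℝ) ≤
          C * (Real.log k * (d / ε)) * Real.log (2 + d / (ε * δ)) ^ 2 := by
  -- From k/2 ≤ k log k ≤ c d one gets k ≤ a d. This and d > 0 are all that is used of the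
  -- assumption on k.
  obtain ⟨a, ha, hca⟩ : ∃ a : ℝ, 1 ≤ a ∧ 2 * c ≤ a := ⟨_, le_max_left 1 (2 * c), le_max_right _ _⟩
  -- R is the scale of the parameters T = ⌈R² L⌉ and m = ⌈R⁴ (d/ε) L²⌉: mε has to exceed dT log m,
  -- whose factors T and log m each bring one L.
  obtain ⟨R, hR⟩ : ∃ R : ℝ, R = 1000 * a := ⟨_, rfl⟩
  have hR0 : 1000 ≤ R := by linarith
  refine ⟨3 * (2 * (R ^ 2) ^ 2 + a * (513 * (4 * a + 6))), by positivity, ?_⟩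
  intro k d ε δ hk hε hε1 hδ hδ1 hkd
  have hk' : (2 : ℝ) ≤ k := by exact_mod_cast hk
  have hlog2 := Real.log_two_gt_d9
  have hlogk : Real.log 2 ≤ Real.log k := Real.log_le_log (by norm_num) hk'
  have hklog : (k : ℝ) / 2 ≤ k * Real.log k := by nlinarith
  have hd : 0 < d := by
    rcases Nat.eq_zero_or_pos d with h | h
    · rw [h] at hkd
      push_cast at hkd
      linarith
    · exact h
  have hka : (k : ℝ) ≤ a * d := by
    have h1 : 2 * c * d ≤ a * d := by gcongr
    linarith
  obtain ⟨hL, hD1, hD, hδ', hδ'a, hkδ⟩ := parameter_bounds hk hε hε1 hδ hδ1 hd hka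
  set L := Real.log (2 + d / (ε * δ)) with hLdef
  set δ' := δ / (2 * Real.logb 2 k) with hδ'def
  set D := (d : ℝ) / ε with hDdef
  set N := (R ^ 2) ^ 2 * D * L ^ 2 with hN
  have hR2 : 1 ≤ R ^ 2 := one_le_pow₀ (by linarith)
  have hR4 : 1 ≤ (R ^ 2) ^ 2 := one_le_pow₀ hR2
  have hL2 : 1 ≤ L ^ 2 := one_le_pow₀ hL
  have hN1 : 1 ≤ N :=
    one_le_mul_of_one_le_of_one_le (one_le_mul_of_one_le_of_one_le hR4 hD1) hL2
  have hT0 : R ^ 2 * L ≤ ⌈R ^ 2 * L⌉₊ := Nat.le_ceil _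
  have hT2 := ceil_le_two_mul (one_le_mul_of_one_le_of_one_le hR2 hL)
  have hT1 : 1 ≤ ⌈R ^ 2 * L⌉₊ := Nat.one_le_ceil_iff.2 (by positivity)
  have hm0 : N ≤ ⌈N⌉₊ := Nat.le_ceil _
  have hm2 := ceil_le_two_mul hN1
  set T := ⌈R ^ 2 * L⌉₊ with hT
  set m := ⌈N⌉₊ with hm
  have hgrow := growth_mul_exp_le ha hR hL hd hδ' hδ'a hD hD1 hN hm2 hε hDdef hm0 hT1 hT2
  refine ⟨hd, m, T, ⌈512 * (Real.log (k / (ε * δ')) / ε)⌉₊, ?_, ?_, hgrow, ?_,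
    boosting_rounds_bound ha hR hL hδ' hδ'a hD hm2 hT0, ?_, ?_⟩
  · refine hT2.trans ?_
    rw [← mul_assoc]
    refine mul_le_mul_of_nonneg_right ?_ (by linarith)
    have : R ^ 2 ≤ (R ^ 2) ^ 2 := le_self_pow₀ hR2 two_ne_zero
    have : 0 ≤ a * (513 * (4 * a + 6)) := by positivity
    linarith
  · have h1 : N * ε ≤ m * ε := by gcongr
    have h2 : N * ε = (R ^ 2) ^ 2 * (d * L ^ 2) := by rw [hN, hDdef]; field_simp
    have h3 : (1 : ℝ) ≤ d * L ^ 2 :=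
      one_le_mul_of_one_le_of_one_le (by exact_mod_cast hd) hL2
    have h4 : (32 : ℝ) ≤ (R ^ 2) ^ 2 := by nlinarith
    nlinarith
  -- The same m serves a single hypothesis, since d ≤ dT + T for T ≥ 1.
  · refine le_trans ?_ hgrow
    gcongr
    · omega
    · nlinarith
  · exact fun S hS => testSize_le (by norm_num) hε hδ' hS
  · have hkt := mul_ceil_log_le ha hL hε hε1 (by positivity) hkδ hka
    calc (Nat.clog 2 k * (m + k * ⌈512 * (Real.log (k / (ε * δ')) / ε)⌉₊) : ℝ)
        ≤ (3 * Real.log k) * (2 * N + a * (513 * (4 * a + 6)) * D * L ^ 2) := by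
          have := clog_le_three_mul_log hk
          have : 0 ≤ Real.log k := by linarith
          gcongr
      _ = _ := by rw [hN]; ring

end Sizes

/-! ### Assembly -/

theorem one_sub_half_le_mul {x p q : ℝ} (hp : p ≤ x / 4) (hq : q ≤ x / 4) (hq0 : 0 ≤ q)
    (hp0 : 0 ≤ p) :
    ENNReal.ofReal (1 - x / 2) ≤ (1 - ENNReal.ofReal p) * (1 - ENNReal.ofReal q) := by
  rw [← ENNReal.ofReal_one, ← ENNReal.ofReal_sub _ hp0, ← ENNReal.ofReal_sub _ hq0]
  rcases le_or_gt 1 p with h | h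
  · rw [ENNReal.ofReal_of_nonpos (p := 1 - x / 2) (by linarith)]
    exact zero_le
  rw [← ENNReal.ofReal_mul (by linarith)]
  refine ENNReal.ofReal_le_ofReal ?_
  nlinarith [mul_nonneg hp0 hq0]

theorem theorem9 :
    ∃ (p : ℕ) (K : ℝ), 0 < K ∧ ∀ c : ℝ, ∃ C : ℝ, 0 < C ∧
      ∀ (k d : ℕ) (ε δ : ℝ), 2 ≤ k → 0 < ε → ε < 1 → 0 < δ → δ < 1 →
        (k : ℝ) * Real.log k ≤ c * d →
        ∃ m n T m' : ℕ,
          (n : ℝ) ≤ K * d ∧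
          (T : ℝ) ≤ C * Real.log (2 + d / (ε * δ)) ∧
          ∀ (X : Type u) [MeasurableSpace X] (H : Set (X → Bool)) (A : Learner X),
            vcDim H = (d : ℕ∞) → A.IsConsistent H → A.IsMeasurable →
            -- Personalized Learning using Boosting
            (IsPersonalizedPAC H ε δ
                (personalizedLearningBoosting (k := k) A m n T K ε δ) ∧
              ((personalizedLearningBoosting (k := k) A m n T K ε δ).samples : ℝ≥0∞) ≤
                ENNReal.ofReal
                  (C * (Real.log k * (d / ε)) * Real.log (2 + d / (ε * δ)) ^ p)) ∧
            -- Personalized Learning, with the same bound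
            (IsPersonalizedPAC H ε δ (personalizedLearning (k := k) A m' K ε δ) ∧
              ((personalizedLearning (k := k) A m' K ε δ).samples : ℝ≥0∞) ≤
                ENNReal.ofReal
                  (C * (Real.log k * (d / ε)) * Real.log (2 + d / (ε * δ)) ^ p)) := by
  -- The exponent 2 is the power of L in m. The constant 512 serves both for n = 512 d and for the
  -- test size.
  refine ⟨2, 512, by norm_num, fun c => ?_⟩
  obtain ⟨C, hC, hsizes⟩ := exists_sizes c
  refine ⟨C, hC, fun k d ε δ hk hε hε1 hδ hδ1 hkd => ?_⟩
  obtain ⟨hd, m, T, t, hT, hm, hgrow, hgrow', hrounds, ht, hcost⟩ :=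
    hsizes k d ε δ hk hε hε1 hδ hδ1 hkd
  refine ⟨m, 512 * d, T, m, by push_cast; exact le_rfl, hT, fun X _ H A hH hA hAm => ?_⟩
  have hsamples : ∀ learn : Finset (Fin k) → Prog k X (X → Bool),
      (∀ N, (learn N).samples ≤ m) → ((personalizedWith learn 512 ε δ).samples : ℝ≥0∞) ≤
        ENNReal.ofReal (C * (Real.log k * (d / ε)) * Real.log (2 + d / (ε * δ)) ^ 2) := by
    intro learn hl
    have h1 : (personalizedWith learn 512 ε δ).samples ≤ (Nat.clog 2 k * (m + k * t) : ℕ) :=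
      samples_personalizedLoop_le hl ht _ _ _
    refine (ENat.toENNReal_mono h1).trans ?_
    rw [ENat.toENNReal_coe, ← ENNReal.ofReal_natCast]
    refine ENNReal.ofReal_le_ofReal ?_
    push_cast
    exact hcost
  refine ⟨⟨isPersonalizedPAC_personalizedWith hk le_rfl hε hε1 hδ hδ1 ?_,
    hsamples _ fun N => samples_distributedBoosting_le A m (512 * d) T N⟩,
    ⟨isPersonalizedPAC_personalizedWith hk le_rfl hε hε1 hδ hδ1 ?_,
    hsamples _ fun N => samples_consistentStep_le A m N⟩⟩
  · intro hstar hs hms D hD N hN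
    exact (one_sub_half_le_mul hgrow hrounds (by positivity) (by positivity)).trans
      (le_expect_distributedBoosting hd hH.le hA hAm hs hms D hN hm)
  · intro hstar hs hms D hD N hN
    have h := one_sub_half_le_mul hgrow' (q := 0) (le_trans (by positivity) hgrow') le_rfl
      (by positivity)
    rw [ENNReal.ofReal_zero, tsub_zero, mul_one] at h
    exact h.trans (le_expect_consistentStep hH.le hA hAm hs hms D hN hm)
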